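/- Let $c\in[0,\sqrt2)$. For a finite signed Borel measure $\mathcal W$ on $\mathbb R$ consider the equation $$ i c u' + u'' + u\,\big(\mathcal W * (1-|u|^2)\big)=0 \quad\text{in }\mathbb R, \qquad (S(\mathcal W,c)) $$ for $u$ in the energy space $$\mathcal E(\mathbb R)=\{v\in H^1_{\rm loc}(\mathbb R;\mathbb C) : 1-|v|^2\in L^2(\mathbb R),\ v'\in L^2(\mathbb R)\}$$ (elements of $H^1_{\rm loc}(\mathbb R)$ are identified with their continuous representatives, and the equation is understood in the sense of distributions). Suppose that one of the following two cases holds. 1. $\mathcal W=\mathcal W_\lambda$ is the nematic potential $\mathcal W_\lambda(x)=\frac1{2|\lambda|}e^{-|x|/|\lambda|}$ with $\lambda>\tilde\lambda_c$, where $$\tilde\lambda_c=c^{-2}\sqrt{4-c^2-\sqrt{8(2-c^2)}}\ \text{ if } c\neq0,\qquad \tilde\lambda_0=\frac1{\sqrt8}.$$ 2. $\mathcal W=\mathcal W_\lambda=\frac{\beta}{\beta-2\lambda}\big(\delta_0-\lambda e^{-\beta|x|}\big)$ with $\beta>0$, $\lambda<0$ such that, with $A_\lambda=\frac{\beta}{\beta-2\lambda}$,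 the number $$\beta^2+2A_\lambda-c^2-\Big((\beta^2+2A_\lambda-c^2)^2-4\beta^2(2A_\lambda-c^2)+16\beta A_\lambda\lambda\Big)^{1/2}\in\mathbb C$$ (principal square root) is either a negative real number or has nonzero imaginary part. Let $u\in\mathcal E(\mathbb R)$ be a nontrivial (i.e. nonconstant) solution of $(S(\mathcal W_\lambda,c))$, and let $\eta=1-|u|^2$. Then there is no $x_0\in\mathbb R$ such that either $$\eta\ge0\ \text{ in }\mathbb R\quad\text{and}\quad \eta'\ge0\ \text{ in }(-\infty,x_0),$$ or $$\eta\le0\ \text{ in }\mathbb R\quad\text{and}\quad \eta'\le0\ \text{ in }(-\infty,x_0).$$ In particular, $\eta$ presents at least one oscillation: there exist $x_1<x_2<x_3$ such that either $\eta'(x_1)>0$, $\eta'(x_2)<0$, $\eta'(x_3)>0$, or $\eta'(x_1)<0$, $\eta'(x_2)>0$, $\eta'(x_3)<0$. In addition, if $c=0$ and $u(x)\to\pm1$ as $x\to\pm\infty$, then $\operatorname{Re}u$ is not nondecreasing on $\mathbb R$. -/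

import Mathlib

open MeasureTheory Filter Topology
open scoped ContDiff

namespace NonlocalGP

noncomputable section

/-- A test function: smooth with compact support on `ℝ`. -/
def IsTest (φ : ℝ → ℝ) : Prop :=
  ContDiff ℝ ∞ φ ∧ HasCompactSupport φ

/-- `g` is a weak (distributional) derivative of `u` on `ℝ`. -/
def IsWeakDeriv (u g : ℝ → ℂ) : Prop :=
  LocallyIntegrable u ∧ LocallyIntegrable g ∧
    ∀ φ : ℝ → ℝ, IsTest φ →
      ∫ x, ((deriv φ x : ℝ) : ℂ) * u x = - ∫ x, ((φ x : ℝ) : ℂ) * g x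

/-- The density deficit `η = 1 - |u|²`. -/
def eta (u : ℝ → ℂ) (x : ℝ) : ℝ := 1 - ‖u x‖ ^ 2

/-- The energy space `{u ∈ H¹_loc(ℝ) : 1 - |u|² ∈ L²(ℝ), u' ∈ L²(ℝ)}`.  As usual in dimension
one, an element of `H¹_loc(ℝ)` is identified with its continuous representative (which is
automatically in `L²_loc(ℝ)`); the derivative is the weak one. -/
def InEnergySpace (u : ℝ → ℂ) : Prop :=
  Continuous u ∧ MemLp (eta u) 2 ∧ ∃ g : ℝ → ℂ, IsWeakDeriv u g ∧ MemLp g 2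

/-- The convolution `(W * f)(x) = ∫ f(x - y) dW(y)` with a finite signed Borel measure `W`. -/
def conv (W : SignedMeasure ℝ) (f : ℝ → ℝ) (x : ℝ) : ℝ :=
  ∫ᵛ y, f (x - y) ∂<•W

/-- `u` solves `i c u' + u'' + u (W * (1 - |u|²)) = 0` in the sense of distributions on `ℝ`. -/
def IsWeakSolution (W : SignedMeasure ℝ) (c : ℝ) (u : ℝ → ℂ) : Prop :=
  ∀ φ : ℝ → ℝ, IsTest φ →
    ∫ x, (-(Complex.I * (c : ℂ) * u x * ((deriv φ x : ℝ) : ℂ))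
      + u x * ((deriv (deriv φ) x : ℝ) : ℂ)
      + u x * ((conv W (eta u) x : ℝ) : ℂ) * ((φ x : ℝ) : ℂ)) = 0

/-- The nematic potential `e^{-|x|/|l|} / (2|l|)`, as a signed measure. -/
def nematicPotential (l : ℝ) : SignedMeasure ℝ :=
  (volume : Measure ℝ).withDensityᵥ fun x => 1 / (2 * |l|) * Real.exp (-(|x| / |l|))

/-- The critical value of the parameter of the nematic potential at speed `c`. -/
def tildeLambda (c : ℝ) : ℝ :=
  if c = 0 then 1 / √8 else (c ^ 2)⁻¹ * √(4 - c ^ 2 - √(8 * (2 - c ^ 2)))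

/-- The constant `A = β / (β - 2 l)`. -/
def coeffA (β l : ℝ) : ℝ := β / (β - 2 * l)

/-- The potential `β / (β - 2 l) (δ₀ - l e^{-β|x|})`, as a signed measure. -/
def deltaExpPotential (β l : ℝ) : SignedMeasure ℝ :=
  coeffA β l • ((Measure.dirac (0 : ℝ)).toSignedMeasure
    - (volume : Measure ℝ).withDensityᵥ fun x => l * Real.exp (-(β * |x|)))

/-- The discriminant of
`S² - (β² + 2A - c²) S + β² (2A - c²) - 4 β A l`, the polynomial (in `S = s²`) obtained from the
characteristic equation `s² - 2 ∫ e^{-s y} dW(y) + c² = 0` of the linearization of the equation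
for `η` at `0`, `W` being the potential `deltaExpPotential β l`. -/
def deltaExpDiscr (β l c : ℝ) : ℝ :=
  (β ^ 2 + 2 * coeffA β l - c ^ 2) ^ 2 - 4 * β ^ 2 * (2 * coeffA β l - c ^ 2)
    + 16 * β * coeffA β l * l

/-- The complex number `β² + 2A - c² - Δ^{1/2}` (principal square root), i.e. twice a root of the
polynomial above. -/
def deltaExpNumber (β l c : ℝ) : ℂ :=
  ((β ^ 2 + 2 * coeffA β l - c ^ 2 : ℝ) : ℂ) - ((deltaExpDiscr β l c : ℝ) : ℂ) ^ (1 / 2 : ℂ)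

/-- A real function presents at least one oscillation. -/
def HasOscillation (f : ℝ → ℝ) : Prop :=
  ∃ x₁ x₂ x₃ : ℝ, x₁ < x₂ ∧ x₂ < x₃ ∧
    ((0 < deriv f x₁ ∧ deriv f x₂ < 0 ∧ 0 < deriv f x₃) ∨
      (deriv f x₁ < 0 ∧ 0 < deriv f x₂ ∧ deriv f x₃ < 0))

end

end NonlocalGP

namespace NonlocalGP

lemma tendsto_exp_mul_atBot {k : ℝ} (hk : 0 < k) :
    Tendsto (fun x : ℝ => Real.exp (k * x)) atBot (𝓝 0) :=
  Real.tendsto_exp_atBot.comp (tendsto_id.const_mul_atBot hk)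

lemma hasDerivAt_exp_mul (k x : ℝ) :
    HasDerivAt (fun x : ℝ => Real.exp (k * x)) (k * Real.exp (k * x)) x := by
  have := ((hasDerivAt_id x).const_mul k).exp
  simpa [mul_comm] using this

/-- A differentiable function with nonnegative derivative on a half-line `(-∞, a]`
is monotone there. -/
lemma monotoneOn_Iic_of_hasDerivAt {f f' : ℝ → ℝ} {a : ℝ} (hf : ∀ x, HasDerivAt f (f' x) x)
    (h : ∀ x < a, 0 ≤ f' x) : MonotoneOn f (Set.Iic a) := by
  refine monotoneOn_of_deriv_nonneg (convex_Iic a)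
    (fun x _ => (hf x).continuousAt.continuousWithinAt)
    (fun x _ => (hf x).differentiableAt.differentiableWithinAt) fun x hx => ?_
  rw [interior_Iic] at hx
  rw [(hf x).deriv]
  exact h x hx

/-- If the logarithmic derivative of `Y > 0` is at most `β`, then `Y` decays at `-∞` no faster
than `e^{βx}`. -/
lemma antitoneOn_exp_neg_mul {β a : ℝ} {Y Y' : ℝ → ℝ} (hY : ∀ x, HasDerivAt Y (Y' x) x)
    (hle : ∀ x < a, Y' x ≤ β * Y x) :
    AntitoneOn (fun x => Real.exp (-β * x) * Y x) (Set.Iic a) := by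
  have hd : ∀ x, HasDerivAt (fun x => -(Real.exp (-β * x) * Y x))
      (Real.exp (-β * x) * (β * Y x - Y' x)) x := fun x => by
    refine ((hasDerivAt_exp_mul (-β) x).mul (hY x)).neg.congr_deriv ?_
    ring
  intro x hx y hy hxy
  have := monotoneOn_Iic_of_hasDerivAt (a := a) hd
    (fun x hx => mul_nonneg (Real.exp_pos _).le (sub_nonneg.2 (hle x hx))) hx hy hxy
  simpa using this

/-- Improvement of the exponential decay rate at `-∞`. -/
lemma decay_step {β κ B C p a s : ℝ} {h h' Y Y' n : ℝ → ℝ} (hβ : 0 < β) (hC : 0 < C) (hp : 0 < p)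
    (hs : 0 ≤ s) (hsβ : s ≤ β)
    (hP : p ≤ B * β ^ 2 + (κ - s ^ 2) * (β ^ 2 - s ^ 2))
    (hh : ∀ x, HasDerivAt h (h' x) x)
    (hh' : ∀ x, HasDerivAt h' (κ * h x + B * Y x + n x) x)
    (hY : ∀ x, HasDerivAt Y (Y' x) x)
    (hY' : ∀ x, HasDerivAt Y' (β ^ 2 * (Y x - h x)) x)
    (hpos : ∀ x ≤ a, 0 < Y x) (hY'le : ∀ x ≤ a, |Y' x| ≤ β * Y x)
    (hhle : ∀ x ≤ a, |h x| ≤ C * Y x) (hh'le : ∀ x ≤ a, |h' x| ≤ C * Y x)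
    (hn : ∀ x ≤ a, |β ^ 2 * n x| ≤ p / 2 * Y x)
    (hlim : Tendsto (fun x => Real.exp (-s * x) * Y x) atBot (𝓝 0)) :
    Tendsto (fun x => Real.exp (-(s + p / (4 * (β ^ 2 * C + (|κ| + β ^ 2) * β
      + β * (β ^ 2 * C + (|κ| + β ^ 2)))) ) * x) * Y x) atBot (𝓝 0) := by
  set D : ℝ := β ^ 2 * C + (|κ| + β ^ 2) * β + β * (β ^ 2 * C + (|κ| + β ^ 2)) with hD
  have hDpos : 0 < D := by positivity
  set F : ℝ → ℝ := fun x => (β ^ 2 * h' x + (κ - s ^ 2) * Y' x)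
    + s * (β ^ 2 * h x + (κ - s ^ 2) * Y x) with hF
  set G : ℝ → ℝ := fun x => Real.exp (-s * x) * F x with hG
  set G' : ℝ → ℝ := fun x => Real.exp (-s * x) *
    ((B * β ^ 2 + (κ - s ^ 2) * (β ^ 2 - s ^ 2)) * Y x + β ^ 2 * n x) with hG'
  have hGd : ∀ x, HasDerivAt G (G' x) x := fun x => by
    have h1 : HasDerivAt F (β ^ 2 * (κ * h x + B * Y x + n x) + (κ - s ^ 2) * (β ^ 2 * (Y x - h x))
        + s * (β ^ 2 * h' x + (κ - s ^ 2) * Y' x)) x :=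
      (((hh' x).const_mul _).add ((hY' x).const_mul _)).add
        ((((hh x).const_mul _).add ((hY x).const_mul _)).const_mul s)
    refine ((hasDerivAt_exp_mul (-s) x).mul h1).congr_deriv ?_
    simp only [hG', hF]
    ring
  have hks : |κ - s ^ 2| ≤ |κ| + β ^ 2 := by
    calc |κ - s ^ 2| ≤ |κ| + |s ^ 2| := abs_sub _ _
      _ ≤ |κ| + β ^ 2 := by rw [abs_of_nonneg (sq_nonneg s)]; gcongr
  have hFle : ∀ x ≤ a, |F x| ≤ D * Y x := fun x hx => by
    have hy := (hpos x hx).le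
    calc |F x| ≤ (|β ^ 2 * h' x| + |(κ - s ^ 2) * Y' x|)
          + |s * (β ^ 2 * h x + (κ - s ^ 2) * Y x)| :=
        (abs_add_le _ _).trans (add_le_add_left (abs_add_le _ _) _)
      _ ≤ (β ^ 2 * (C * Y x) + (|κ| + β ^ 2) * (β * Y x))
          + β * (β ^ 2 * (C * Y x) + (|κ| + β ^ 2) * Y x) := by
        rw [abs_mul, abs_mul, abs_mul, abs_of_nonneg (sq_nonneg β), abs_of_nonneg hs]
        gcongr
        · exact hh'le x hx
        · exact hY'le x hx
        · refine (abs_add_le _ _).trans ?_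
          rw [abs_mul, abs_mul, abs_of_nonneg (sq_nonneg β), abs_of_nonneg hy]
          gcongr
          exact hhle x hx
      _ = D * Y x := by rw [hD]; ring
  have hG'ge : ∀ x ≤ a, p / 2 * (Real.exp (-s * x) * Y x) ≤ G' x := fun x hx => by
    have h1 := (abs_le.1 (hn x hx)).1
    have h2 : p * Y x ≤ (B * β ^ 2 + (κ - s ^ 2) * (β ^ 2 - s ^ 2)) * Y x :=
      mul_le_mul_of_nonneg_right hP (hpos x hx).le
    calc p / 2 * (Real.exp (-s * x) * Y x) = Real.exp (-s * x) * (p / 2 * Y x) := by ring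
      _ ≤ G' x := mul_le_mul_of_nonneg_left (by linarith) (Real.exp_pos _).le
  have hG'nn : ∀ x ≤ a, 0 ≤ G' x := fun x hx =>
    (mul_nonneg (by positivity) (mul_nonneg (Real.exp_pos _).le (hpos x hx).le)).trans (hG'ge x hx)
  have hGle : ∀ x ≤ a, |G x| ≤ D * (Real.exp (-s * x) * Y x) := fun x hx => by
    rw [hG]
    simp only [abs_mul, Real.abs_exp]
    calc Real.exp (-s * x) * |F x| ≤ Real.exp (-s * x) * (D * Y x) :=
        mul_le_mul_of_nonneg_left (hFle x hx) (Real.exp_pos _).le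
      _ = _ := by ring
  have hGlim : Tendsto G atBot (𝓝 0) := by
    refine squeeze_zero_norm' (a := fun x => D * (Real.exp (-s * x) * Y x)) ?_
      (by simpa using hlim.const_mul D)
    filter_upwards [eventually_le_atBot a] with x hx using hGle x hx
  have hGmono : MonotoneOn G (Set.Iic a) :=
    monotoneOn_Iic_of_hasDerivAt hGd fun x hx => hG'nn x hx.le
  have hGnn : ∀ x ≤ a, 0 ≤ G x := fun x hx => by
    refine le_of_tendsto hGlim ?_
    filter_upwards [eventually_le_atBot x] with y hy using hGmono (hy.trans hx) hx hy
  set k : ℝ := p / (2 * D) with hk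
  have hkpos : 0 < k := by positivity
  have hkG : ∀ x ≤ a, k * G x ≤ G' x := fun x hx => by
    refine le_trans ?_ (hG'ge x hx)
    calc k * G x ≤ k * (D * (Real.exp (-s * x) * Y x)) :=
        mul_le_mul_of_nonneg_left ((le_abs_self _).trans (hGle x hx)) hkpos.le
      _ = _ := by rw [hk]; field_simp
  have hGexp : ∀ x ≤ a, G x ≤ Real.exp (-k * a) * G a * Real.exp (k * x) := fun x hx => by
    have hd : ∀ x, HasDerivAt (fun x => Real.exp (-k * x) * G x)
        (Real.exp (-k * x) * (G' x - k * G x)) x := fun x => by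
      refine ((hasDerivAt_exp_mul (-k) x).mul (hGd x)).congr_deriv ?_
      ring
    have := monotoneOn_Iic_of_hasDerivAt (a := a) hd
      (fun x hx => mul_nonneg (Real.exp_pos _).le (sub_nonneg.2 (hkG x hx.le)))
      hx (Set.mem_Iic.2 le_rfl) hx
    calc G x = Real.exp (-k * x) * G x * Real.exp (k * x) := by
          rw [mul_right_comm, ← Real.exp_add]; simp
      _ ≤ _ := mul_le_mul_of_nonneg_right this (Real.exp_pos _).le
  have hanti := antitoneOn_exp_neg_mul (a := a) hY
    (fun x hx => (le_abs_self _).trans (hY'le x hx.le))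
  have hGlow : ∀ x ≤ a, p / 2 * Real.exp (-β) * (Real.exp (-s * x) * Y x) ≤ G x := fun x hx => by
    obtain ⟨ξ, hξ, hξe⟩ := exists_hasDerivAt_eq_slope G G' (show x - 1 < x by linarith)
      (fun y _ => (hGd y).continuousAt.continuousWithinAt) (fun y _ => hGd y)
    have h1 : G' ξ ≤ G x := by
      have := hGnn (x - 1) (by linarith)
      rw [hξe]
      simp only [sub_sub_cancel, div_one]
      linarith
    refine le_trans ?_ h1
    have hξa : ξ ≤ a := hξ.2.le.trans hx
    refine le_trans ?_ (hG'ge ξ hξa)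
    have h2 : Real.exp (-β) * Y x ≤ Y ξ := by
      have h3 := hanti hξa hx hξ.2.le
      simp only at h3
      calc Real.exp (-β) * Y x ≤ Real.exp (β * ξ + -β * x) * Y x := by
            refine mul_le_mul_of_nonneg_right (Real.exp_le_exp.2 ?_) (hpos x hx).le
            nlinarith [hξ.1]
        _ = Real.exp (β * ξ) * (Real.exp (-β * x) * Y x) := by rw [Real.exp_add]; ring
        _ ≤ Real.exp (β * ξ) * (Real.exp (-β * ξ) * Y ξ) :=
            mul_le_mul_of_nonneg_left h3 (Real.exp_pos _).le
        _ = Y ξ := by rw [← mul_assoc, ← Real.exp_add]; simp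
    have h4 : Real.exp (-s * x) ≤ Real.exp (-s * ξ) :=
      Real.exp_le_exp.2 (by nlinarith [hξ.2])
    calc p / 2 * Real.exp (-β) * (Real.exp (-s * x) * Y x)
        = p / 2 * (Real.exp (-s * x) * (Real.exp (-β) * Y x)) := by ring
      _ ≤ p / 2 * (Real.exp (-s * ξ) * Y ξ) := by
        gcongr
        exact mul_nonneg (Real.exp_pos _).le (hpos x hx).le
  set M : ℝ := Real.exp (-k * a) * G a / (p / 2 * Real.exp (-β)) with hM
  refine squeeze_zero_norm' (a := fun x => M * Real.exp (k / 2 * x)) ?_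
    (by simpa using (tendsto_exp_mul_atBot (half_pos hkpos)).const_mul M)
  filter_upwards [eventually_le_atBot a] with x hx
  rw [Real.norm_of_nonneg (mul_nonneg (Real.exp_pos _).le (hpos x hx).le)]
  have h1 : Real.exp (-s * x) * Y x ≤ M * Real.exp (k * x) := by
    rw [hM, div_mul_eq_mul_div, le_div_iff₀ (by positivity), mul_comm]
    exact (hGlow x hx).trans (hGexp x hx)
  have h2 : p / (4 * D) = k / 2 := by rw [hk]; field_simp; norm_num
  calc Real.exp (-(s + p / (4 * D)) * x) * Y x
      = Real.exp (-(k / 2) * x) * (Real.exp (-s * x) * Y x) := by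
        rw [h2, ← mul_assoc, ← Real.exp_add]; ring_nf
    _ ≤ Real.exp (-(k / 2) * x) * (M * Real.exp (k * x)) :=
        mul_le_mul_of_nonneg_left h1 (Real.exp_pos _).le
    _ = M * Real.exp (k / 2 * x) := by
        rw [mul_left_comm, ← Real.exp_add]; ring_nf

/-- A perturbation of the linear system `h'' = κ h + B Y`, `Y'' = β² (Y - h)` has no solution
decaying at `-∞` with `Y > 0` dominating `h` and `h'`, provided that the characteristic polynomial
`S² - (κ + β²) S + (κ + B) β²` is positive on the nonnegative half-line. -/
theorem not_exists_dominated_solution {β κ B C a : ℝ} {h h' Y Y' n : ℝ → ℝ}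
    (hβ : 0 < β) (hC : 0 < C)
    (hP : ∀ S : ℝ, 0 ≤ S → 0 < B * β ^ 2 + (κ - S) * (β ^ 2 - S))
    (hh : ∀ x, HasDerivAt h (h' x) x)
    (hh' : ∀ x, HasDerivAt h' (κ * h x + B * Y x + n x) x)
    (hY : ∀ x, HasDerivAt Y (Y' x) x)
    (hY' : ∀ x, HasDerivAt Y' (β ^ 2 * (Y x - h x)) x)
    (hpos : ∀ x ≤ a, 0 < Y x) (hY'le : ∀ x ≤ a, |Y' x| ≤ β * Y x)
    (hhle : ∀ x ≤ a, |h x| ≤ C * Y x) (hh'le : ∀ x ≤ a, |h' x| ≤ C * Y x)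
    (hn : ∀ x ≤ a, |n x| ≤ C * Y x ^ 2) (hlim : Tendsto Y atBot (𝓝 0)) : False := by
  obtain ⟨S₀, hS₀, hmin⟩ := (isCompact_Icc (a := (0 : ℝ)) (b := β ^ 2)).exists_isMinOn
    (f := fun S : ℝ => B * β ^ 2 + (κ - S) * (β ^ 2 - S))
    (Set.nonempty_Icc.2 (sq_nonneg β)) (by fun_prop)
  set p : ℝ := B * β ^ 2 + (κ - S₀) * (β ^ 2 - S₀) with hp
  have hp0 : 0 < p := hP S₀ hS₀.1
  have hev : ∀ᶠ x in atBot, Y x < p / (2 * β ^ 2 * C) :=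
    hlim.eventually_lt_const (by positivity)
  obtain ⟨b, hb⟩ := eventually_atBot.1 hev
  set d := min a b
  have hda : d ≤ a := min_le_left _ _
  have hn' : ∀ x ≤ d, |β ^ 2 * n x| ≤ p / 2 * Y x := fun x hx => by
    have hxa := hx.trans hda
    have h1 := hb x (hx.trans (min_le_right _ _))
    have h2 := hpos x hxa
    rw [abs_mul, abs_of_nonneg (sq_nonneg β)]
    calc β ^ 2 * |n x| ≤ β ^ 2 * (C * Y x ^ 2) := by gcongr; exact hn x hxa
      _ = β ^ 2 * C * Y x * Y x := by ring
      _ ≤ p / 2 * Y x := by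
        refine mul_le_mul_of_nonneg_right ?_ h2.le
        rw [lt_div_iff₀ (by positivity)] at h1
        nlinarith
  set D : ℝ := β ^ 2 * C + (|κ| + β ^ 2) * β + β * (β ^ 2 * C + (|κ| + β ^ 2)) with hD
  have hDpos : 0 < D := by positivity
  set δ : ℝ := p / (4 * D) with hδ
  have hδpos : 0 < δ := by positivity
  have hind : ∀ m : ℕ, Tendsto (fun x => Real.exp (-(min (m * δ) β) * x) * Y x) atBot (𝓝 0) := by
    intro m
    induction m with
    | zero => simpa [hβ.le] using hlim
    | succ m ih =>
      set s := min (m * δ) β with hs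
      have hs0 : 0 ≤ s := le_min (by positivity) hβ.le
      have hsβ : s ≤ β := min_le_right _ _
      have hstep := decay_step (a := d) hβ hC hp0 hs0 hsβ
        (hmin ⟨sq_nonneg s, by gcongr⟩) hh hh' hY hY'
        (fun x hx => hpos x (hx.trans hda)) (fun x hx => hY'le x (hx.trans hda))
        (fun x hx => hhle x (hx.trans hda)) (fun x hx => hh'le x (hx.trans hda)) hn' ih
      refine squeeze_zero_norm' ?_ hstep
      filter_upwards [eventually_le_atBot d, eventually_le_atBot 0] with x hx hx0
      have hy := (hpos x (hx.trans hda)).le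
      rw [Real.norm_of_nonneg (mul_nonneg (Real.exp_pos _).le hy)]
      refine mul_le_mul_of_nonneg_right (Real.exp_le_exp.2 ?_) hy
      refine mul_le_mul_of_nonpos_right (neg_le_neg ?_) hx0
      push_cast
      rcases min_choice (m * δ) β with h1 | h1
      · rw [hs, h1]
        exact (min_le_left _ _).trans (by rw [hδ]; linarith)
      · rw [hs, h1]
        exact (min_le_right _ _).trans (by linarith)
  obtain ⟨m, hm⟩ := exists_nat_gt (β / δ)
  have hβlim := hind m
  rw [min_eq_right ((div_lt_iff₀ hδpos).1 hm).le] at hβlim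
  have hanti := antitoneOn_exp_neg_mul (a := a) hY
    (fun x hx => (le_abs_self _).trans (hY'le x hx.le))
  have hge : Real.exp (-β * a) * Y a ≤ 0 := by
    refine ge_of_tendsto hβlim ?_
    filter_upwards [eventually_le_atBot a] with x hx
      using hanti hx (Set.mem_Iic.2 le_rfl) hx
  exact absurd hge (not_le.2 (mul_pos (Real.exp_pos _) (hpos a le_rfl)))

/-- A nonconstant differentiable function which tends to the same value `0` at `±∞`, and is neither
nonnegative and nondecreasing near `-∞` nor nonpositive and nonincreasing near `-∞`, presents an
oscillation. -/
theorem hasOscillation_of_tendsto {f : ℝ → ℝ} (hf : Differentiable ℝ f)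
    (hbot : Tendsto f atBot (𝓝 0)) (htop : Tendsto f atTop (𝓝 0))
    (h1 : ¬ ∃ x₀ : ℝ, (∀ x, 0 ≤ f x) ∧ ∀ x < x₀, 0 ≤ deriv f x)
    (h2 : ¬ ∃ x₀ : ℝ, (∀ x, f x ≤ 0) ∧ ∀ x < x₀, deriv f x ≤ 0) : HasOscillation f := by
  have key : ∀ g : ℝ → ℝ, Differentiable ℝ g → Tendsto g atBot (𝓝 0) → Tendsto g atTop (𝓝 0) →
      ¬ HasOscillation g → ∀ a b : ℝ, a < b → 0 < deriv g a → deriv g b < 0 →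
      ∃ x₀ : ℝ, (∀ x, 0 ≤ g x) ∧ ∀ x < x₀, 0 ≤ deriv g x := by
    intro g hg gbot gtop hosc a b hab ha hb
    have hl : ∀ x < a, 0 ≤ deriv g x := fun x hx => by
      by_contra! hneg
      exact hosc ⟨x, a, b, hx, hab, Or.inr ⟨hneg, ha, hb⟩⟩
    have hr : ∀ x, b < x → deriv g x ≤ 0 := fun x hx => by
      by_contra! hneg
      exact hosc ⟨a, b, x, hab, hx, Or.inl ⟨ha, hb, hneg⟩⟩
    have hmono : MonotoneOn g (Set.Iic a) :=
      monotoneOn_Iic_of_hasDerivAt (fun x => (hg x).hasDerivAt) hl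
    have hanti : AntitoneOn g (Set.Ici b) :=
      antitoneOn_of_deriv_nonpos (convex_Ici b) hg.continuous.continuousOn
        hg.differentiableOn fun x hx => hr x (by simpa using hx)
    have hla : ∀ x ≤ a, 0 ≤ g x := fun x hx => by
      refine le_of_tendsto gbot ?_
      filter_upwards [eventually_le_atBot x] with y hy using hmono (hy.trans hx) hx hy
    have hrb : ∀ x, b ≤ x → 0 ≤ g x := fun x hx => by
      refine le_of_tendsto gtop ?_
      filter_upwards [eventually_ge_atTop x] with y hy using hanti hx (hx.trans hy) hy
    refine ⟨a, fun x => ?_, hl⟩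
    by_contra! hneg
    have hax : a < x := by
      by_contra! hle
      exact absurd (hla x hle) (not_le.2 hneg)
    have hxb : x < b := by
      by_contra! hle
      exact absurd (hrb x hle) (not_le.2 hneg)
    obtain ⟨y, hy, hye⟩ := exists_deriv_eq_slope g hax hg.continuous.continuousOn
      hg.differentiableOn
    obtain ⟨z, hz, hze⟩ := exists_deriv_eq_slope g hxb hg.continuous.continuousOn
      hg.differentiableOn
    refine hosc ⟨a, y, z, hy.1, hy.2.trans hz.1, Or.inl ⟨ha, ?_, ?_⟩⟩
    · rw [hye]
      exact div_neg_of_neg_of_pos (by linarith [hla a le_rfl]) (by linarith)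
    · rw [hze]
      exact div_pos (by linarith [hrb b le_rfl]) (by linarith)
  have hconst : ∀ g : ℝ → ℝ, Differentiable ℝ g → Tendsto g atBot (𝓝 0) → Tendsto g atTop (𝓝 0) →
      (∀ x, 0 ≤ deriv g x) → ∀ x, g x = 0 := by
    intro g hg gbot gtop hd x
    have hm := monotone_of_deriv_nonneg hg hd
    exact le_antisymm (hm.ge_of_tendsto gtop x) (hm.le_of_tendsto gbot x)
  have hneg : ∀ x, deriv (fun y => -f y) x = -deriv f x := fun x => deriv.fun_neg
  have hfn : Differentiable ℝ fun y => -f y := hf.neg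
  have hbn : Tendsto (fun y => -f y) atBot (𝓝 0) := by simpa using hbot.neg
  have htn : Tendsto (fun y => -f y) atTop (𝓝 0) := by simpa using htop.neg
  by_contra hosc
  have hoscn : ¬ HasOscillation fun y => -f y := by
    rintro ⟨x, y, z, hxy, hyz, h⟩
    simp only [hneg, Left.neg_pos_iff, Left.neg_neg_iff] at h
    exact hosc ⟨x, y, z, hxy, hyz, h.symm⟩
  by_cases hp : ∃ a, 0 < deriv f a
  · obtain ⟨a, ha⟩ := hp
    by_cases hm : ∃ b, deriv f b < 0
    · obtain ⟨b, hb⟩ := hm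
      rcases lt_trichotomy a b with hab | rfl | hab
      · exact h1 (key f hf hbot htop hosc a b hab ha hb)
      · exact absurd ha (not_lt.2 hb.le)
      · obtain ⟨x₀, hx, hx'⟩ := key _ hfn hbn htn hoscn b a hab (by rw [hneg]; linarith)
          (by rw [hneg]; linarith)
        exact h2 ⟨x₀, fun x => by linarith [hx x], fun x h => by
          have := hx' x h
          rw [hneg] at this
          linarith⟩
    · push Not at hm
      exact h1 ⟨0, fun x => (hconst f hf hbot htop hm x).ge, fun x _ => hm x⟩
  · push Not at hp
    have h0 := hconst _ hfn hbn htn (fun x => by rw [hneg]; linarith [hp x])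
    exact h2 ⟨0, fun x => by linarith [h0 x], fun x _ => hp x⟩

/-- The exponential average `∫_0^∞ e^{-βy} f(x - y) dy` of the past of `f`. -/
noncomputable def leftAvg (β : ℝ) (f : ℝ → ℝ) (x : ℝ) : ℝ :=
  ∫ y in Set.Ioi 0, Real.exp (-(β * y)) * f (x - y)

/-- The exponential average `∫_0^∞ e^{-βy} f(x + y) dy` of the future of `f`. -/
noncomputable def rightAvg (β : ℝ) (f : ℝ → ℝ) (x : ℝ) : ℝ :=
  ∫ y in Set.Ioi 0, Real.exp (-(β * y)) * f (x + y)

lemma rightAvg_eq (β : ℝ) (f : ℝ → ℝ) (x : ℝ) :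
    rightAvg β f x = leftAvg β (fun y => f (-y)) (-x) := by
  unfold rightAvg leftAvg
  congr 1 with y
  ring_nf

lemma memLp_sub_left {f : ℝ → ℝ} (hf : MemLp f 2) (x : ℝ) : MemLp (fun y => f (x - y)) 2 :=
  hf.comp_measurePreserving (volume.measurePreserving_sub_left x)

lemma memLp_comp_neg {f : ℝ → ℝ} (hf : MemLp f 2) : MemLp (fun y => f (-y)) 2 :=
  hf.comp_measurePreserving (Measure.measurePreserving_neg volume)

lemma memLp_exp_neg {β : ℝ} (hβ : 0 < β) :
    MemLp (fun y => Real.exp (-(β * y))) 2 (volume.restrict (Set.Ioi 0)) := by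
  rw [memLp_two_iff_integrable_sq (by fun_prop)]
  have := integrableOn_exp_mul_Ioi (a := -(2 * β)) (by linarith) 0
  refine this.congr (Eventually.of_forall fun y => ?_)
  simp only [← Real.exp_nat_mul]
  congr 1
  push_cast
  ring

lemma integrableOn_exp_mul_sub {β : ℝ} (hβ : 0 < β) {f : ℝ → ℝ} (hf : MemLp f 2) (x : ℝ) :
    IntegrableOn (fun y => Real.exp (-(β * y)) * f (x - y)) (Set.Ioi 0) :=
  (memLp_exp_neg hβ).integrable_mul ((memLp_sub_left hf x).restrict _)

lemma integrableOn_exp_mul_add {β : ℝ} (hβ : 0 < β) {f : ℝ → ℝ} (hf : MemLp f 2) (x : ℝ) :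
    IntegrableOn (fun y => Real.exp (-(β * y)) * f (x + y)) (Set.Ioi 0) := by
  have := integrableOn_exp_mul_sub hβ (memLp_comp_neg hf) (-x)
  refine this.congr_fun (fun y _ => ?_) measurableSet_Ioi
  ring_nf

lemma leftAvg_eq_integral_Iic (β : ℝ) (f : ℝ → ℝ) (x : ℝ) :
    leftAvg β f x = Real.exp (-β * x) * ∫ t in Set.Iic x, Real.exp (β * t) * f t := by
  have hmp := (volume : Measure ℝ).measurePreserving_sub_left x
  have hpre : (fun y => x - y) ⁻¹' Set.Iio x = Set.Ioi 0 := by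
    ext y
    simp
  have := hmp.setIntegral_preimage_emb (Homeomorph.subLeft x).measurableEmbedding
    (fun t => Real.exp (-β * (x - t)) * f t) (Set.Iio x)
  rw [hpre] at this
  rw [integral_Iic_eq_integral_Iio, ← integral_const_mul, leftAvg]
  refine Eq.trans (integral_congr_ae (Eventually.of_forall fun y => ?_))
    (this.trans (integral_congr_ae (Eventually.of_forall fun t => ?_)))
  · simp
  · simp only
    rw [← mul_assoc, ← Real.exp_add]
    ring_nf

lemma integrableOn_Iic_exp_mul {β : ℝ} (hβ : 0 < β) {f : ℝ → ℝ} (hf : MemLp f 2) (x : ℝ) :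
    IntegrableOn (fun t => Real.exp (β * t) * f t) (Set.Iic x) := by
  have hmp := (volume : Measure ℝ).measurePreserving_sub_left x
  have hpre : (fun y => x - y) ⁻¹' Set.Iio x = Set.Ioi 0 := by
    ext y
    simp
  rw [integrableOn_Iic_iff_integrableOn_Iio,
    ← hmp.integrableOn_comp_preimage (Homeomorph.subLeft x).measurableEmbedding, hpre]
  refine IntegrableOn.congr_fun
    (Integrable.const_mul (integrableOn_exp_mul_sub hβ hf x) (Real.exp (β * x)))
    (fun y _ => ?_) measurableSet_Ioi
  simp only [Function.comp]
  rw [← mul_assoc, ← Real.exp_add]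
  ring_nf

lemma hasDerivAt_leftAvg {β : ℝ} (hβ : 0 < β) {f : ℝ → ℝ} (hf : MemLp f 2) (hc : Continuous f)
    (x : ℝ) : HasDerivAt (leftAvg β f) (f x - β * leftAvg β f x) x := by
  set g : ℝ → ℝ := fun t => Real.exp (β * t) * f t with hg
  have hgc : Continuous g := by fun_prop
  have heq : leftAvg β f = fun x => Real.exp (-β * x) *
      ((∫ t in Set.Iic 0, g t) + ∫ t in (0 : ℝ)..x, g t) := by
    funext z
    rw [leftAvg_eq_integral_Iic, ← intervalIntegral.integral_Iic_sub_Iic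
      (integrableOn_Iic_exp_mul hβ hf 0) (integrableOn_Iic_exp_mul hβ hf z)]
    ring
  have h1 : HasDerivAt (fun x => ∫ t in (0 : ℝ)..x, g t) (g x) x :=
    intervalIntegral.integral_hasDerivAt_right (hgc.intervalIntegrable _ _)
      (hgc.stronglyMeasurableAtFilter _ _) hgc.continuousAt
  have h2 := (hasDerivAt_exp_mul (-β) x).mul (h1.const_add (∫ t in Set.Iic 0, g t))
  rw [heq]
  refine h2.congr_deriv ?_
  have h3 : Real.exp (-β * x) * g x = f x := by
    rw [hg]
    simp only
    rw [← mul_assoc, ← Real.exp_add]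
    simp
  simp only
  linear_combination h3

lemma hasDerivAt_rightAvg {β : ℝ} (hβ : 0 < β) {f : ℝ → ℝ} (hf : MemLp f 2) (hc : Continuous f)
    (x : ℝ) : HasDerivAt (rightAvg β f) (β * rightAvg β f x - f x) x := by
  have h := hasDerivAt_leftAvg hβ (memLp_comp_neg hf) (hc.comp continuous_neg) (-x)
  have heq : rightAvg β f = fun x => leftAvg β (fun y => f (-y)) (-x) :=
    funext (rightAvg_eq β f)
  rw [heq]
  refine (h.comp x (hasDerivAt_neg x)).congr_deriv ?_
  simp

lemma leftAvg_nonneg {β : ℝ} {f : ℝ → ℝ} (hf : ∀ x, 0 ≤ f x) (x : ℝ) : 0 ≤ leftAvg β f x :=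
  integral_nonneg fun _ => mul_nonneg (Real.exp_pos _).le (hf _)

lemma rightAvg_nonneg {β : ℝ} {f : ℝ → ℝ} (hf : ∀ x, 0 ≤ f x) (x : ℝ) : 0 ≤ rightAvg β f x :=
  integral_nonneg fun _ => mul_nonneg (Real.exp_pos _).le (hf _)

lemma integrableOn_exp_neg_mul {β : ℝ} (hβ : 0 < β) :
    IntegrableOn (fun y => Real.exp (-(β * y))) (Set.Ioi 0) := by
  simpa using integrableOn_exp_mul_Ioi (a := -β) (by linarith) 0

lemma abs_leftAvg_le {β M : ℝ} (hβ : 0 < β) {f : ℝ → ℝ} (hM : ∀ x, |f x| ≤ M) (x : ℝ) :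
    |leftAvg β f x| ≤ M * ∫ y in Set.Ioi 0, Real.exp (-(β * y)) := by
  rw [← integral_const_mul, ← Real.norm_eq_abs, leftAvg]
  refine norm_integral_le_of_norm_le ((integrableOn_exp_neg_mul hβ).const_mul M)
    (Eventually.of_forall fun y => ?_)
  rw [norm_mul, Real.norm_eq_abs, Real.abs_exp, mul_comm]
  exact mul_le_mul_of_nonneg_right (hM _) (Real.exp_pos _).le

lemma abs_rightAvg_le {β M : ℝ} (hβ : 0 < β) {f : ℝ → ℝ} (hM : ∀ x, |f x| ≤ M) (x : ℝ) :
    |rightAvg β f x| ≤ M * ∫ y in Set.Ioi 0, Real.exp (-(β * y)) := by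
  rw [rightAvg_eq]
  exact abs_leftAvg_le hβ (fun y => hM (-y)) _

lemma tendsto_leftAvg {β M : ℝ} (hβ : 0 < β) {f : ℝ → ℝ} (hc : Continuous f) (hM : ∀ x, |f x| ≤ M)
    {l l' : Filter ℝ} [l.IsCountablyGenerated] (hlim : Tendsto f l' (𝓝 0))
    (hl : ∀ y, Tendsto (fun x => x - y) l l') : Tendsto (leftAvg β f) l (𝓝 0) := by
  have : Tendsto (fun x => ∫ y in Set.Ioi 0, Real.exp (-(β * y)) * f (x - y)) l
      (𝓝 (∫ y in Set.Ioi (0 : ℝ), (0 : ℝ))) := by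
    refine tendsto_integral_filter_of_dominated_convergence
      (fun y => M * Real.exp (-(β * y))) ?_ ?_ ((integrableOn_exp_neg_mul hβ).const_mul M) ?_
    · exact Eventually.of_forall fun x => Continuous.aestronglyMeasurable (by fun_prop)
    · refine Eventually.of_forall fun x => Eventually.of_forall fun y => ?_
      rw [norm_mul, Real.norm_eq_abs, Real.abs_exp, mul_comm]
      exact mul_le_mul_of_nonneg_right (hM _) (Real.exp_pos _).le
    · refine Eventually.of_forall fun y => ?_
      simpa using (hlim.comp (hl y)).const_mul (Real.exp (-(β * y)))
  rw [integral_zero] at this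
  exact this

lemma tendsto_leftAvg_atBot {β M : ℝ} (hβ : 0 < β) {f : ℝ → ℝ} (hc : Continuous f)
    (hM : ∀ x, |f x| ≤ M) (hlim : Tendsto f atBot (𝓝 0)) : Tendsto (leftAvg β f) atBot (𝓝 0) :=
  tendsto_leftAvg hβ hc hM hlim fun y => tendsto_atBot_add_const_right _ (-y) tendsto_id

lemma tendsto_rightAvg_atBot {β M : ℝ} (hβ : 0 < β) {f : ℝ → ℝ} (hc : Continuous f)
    (hM : ∀ x, |f x| ≤ M) (hlim : Tendsto f atBot (𝓝 0)) :
    Tendsto (rightAvg β f) atBot (𝓝 0) := by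
  have h := tendsto_leftAvg (l := atTop) (l' := atTop) hβ (hc.comp continuous_neg)
    (fun y => hM (-y)) (hlim.comp tendsto_neg_atTop_atBot)
    fun y => tendsto_atTop_add_const_right _ (-y) tendsto_id
  exact (h.comp tendsto_neg_atBot_atTop).congr fun x => (rightAvg_eq β f x).symm

lemma integrable_exp_neg_abs_mul_of_integrableOn {β : ℝ} {f : ℝ → ℝ} {x : ℝ}
    (hl : IntegrableOn (fun y => Real.exp (-(β * y)) * f (x - y)) (Set.Ioi 0))
    (hr : IntegrableOn (fun y => Real.exp (-(β * y)) * f (x + y)) (Set.Ioi 0)) :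
    Integrable (fun y => Real.exp (-(β * |y|)) * f (x - y)) ∧
      ∫ y, Real.exp (-(β * |y|)) * f (x - y) = leftAvg β f x + rightAvg β f x := by
  have h1 : IntegrableOn (fun y => Real.exp (-(β * |y|)) * f (x - y)) (Set.Ioi 0) :=
    hl.congr_fun
      (fun y hy => by simp only [abs_of_pos (Set.mem_Ioi.1 hy)]) measurableSet_Ioi
  have hmp := Measure.measurePreserving_neg (volume : Measure ℝ)
  have hpre : (fun y : ℝ => -y) ⁻¹' Set.Iio 0 = Set.Ioi 0 := by
    ext y
    simp
  have hcongr : Set.EqOn (fun y => Real.exp (-(β * y)) * f (x + y))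
      (fun y => Real.exp (-(β * |-y|)) * f (x - -y)) (Set.Ioi 0) := fun y hy => by
    simp only [abs_neg, abs_of_pos (Set.mem_Ioi.1 hy), sub_neg_eq_add]
  have h2 : IntegrableOn (fun y => Real.exp (-(β * |y|)) * f (x - y)) (Set.Iic 0) := by
    rw [integrableOn_Iic_iff_integrableOn_Iio,
      ← hmp.integrableOn_comp_preimage (Homeomorph.neg ℝ).measurableEmbedding, hpre]
    exact hr.congr_fun hcongr measurableSet_Ioi
  have h3 : ∫ y in Set.Iic 0, Real.exp (-(β * |y|)) * f (x - y) = rightAvg β f x := by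
    have := hmp.setIntegral_preimage_emb (Homeomorph.neg ℝ).measurableEmbedding
      (fun y => Real.exp (-(β * |y|)) * f (x - y)) (Set.Iio 0)
    rw [integral_Iic_eq_integral_Iio, ← this, hpre, rightAvg]
    exact (setIntegral_congr_fun measurableSet_Ioi hcongr).symm
  have h4 : ∫ y in Set.Ioi 0, Real.exp (-(β * |y|)) * f (x - y) = leftAvg β f x :=
    setIntegral_congr_fun measurableSet_Ioi
      fun y hy => by simp only [abs_of_pos (Set.mem_Ioi.1 hy)]
  have hint : Integrable (fun y => Real.exp (-(β * |y|)) * f (x - y)) := by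
    rw [← integrableOn_univ, ← Set.Iic_union_Ioi (a := (0 : ℝ))]
    exact h2.union h1
  refine ⟨hint, ?_⟩
  rw [← setIntegral_univ, ← Set.Iic_union_Ioi (a := (0 : ℝ)),
    setIntegral_union (Set.Iic_disjoint_Ioi le_rfl) measurableSet_Ioi h2 h1, h3, h4, add_comm]

lemma integrable_exp_neg_abs_mul {β : ℝ} (hβ : 0 < β) {f : ℝ → ℝ} (hf : MemLp f 2) (x : ℝ) :
    Integrable (fun y => Real.exp (-(β * |y|)) * f (x - y)) ∧
      ∫ y, Real.exp (-(β * |y|)) * f (x - y) = leftAvg β f x + rightAvg β f x :=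
  integrable_exp_neg_abs_mul_of_integrableOn (integrableOn_exp_mul_sub hβ hf x)
    (integrableOn_exp_mul_add hβ hf x)

lemma integrable_exp_neg_abs {β : ℝ} (hβ : 0 < β) :
    Integrable fun y : ℝ => Real.exp (-(β * |y|)) := by
  have h := integrableOn_exp_neg_mul hβ
  simpa using (integrable_exp_neg_abs_mul_of_integrableOn (f := fun _ => 1) (x := 0)
    (by simpa using h) (by simpa using h)).1

lemma withDensityv_eq_toSignedMeasure {k : ℝ → ℝ} (hk : Integrable k) (h0 : ∀ x, 0 ≤ k x) :
    (volume : Measure ℝ).withDensityᵥ k = @Measure.toSignedMeasure ℝ _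
      ((volume : Measure ℝ).withDensity fun x => ENNReal.ofReal (k x))
      (isFiniteMeasure_withDensity_ofReal hk.2) := by
  have h := withDensityᵥ_toReal (μ := (volume : Measure ℝ)) (f := fun x => ENNReal.ofReal (k x))
    hk.aemeasurable.ennreal_ofReal
    ((hasFiniteIntegral_iff_ofReal (Eventually.of_forall h0)).1 hk.2).ne
  simp only [ENNReal.toReal_ofReal (h0 _)] at h
  exact h

lemma integral_withDensityv {k f : ℝ → ℝ} (hk : Integrable k) (hkm : Measurable k)
    (h0 : ∀ x, 0 ≤ k x)  :
    ∫ᵛ y, f y ∂<•((volume : Measure ℝ).withDensityᵥ k) = ∫ y, k y * f y := by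
  have := isFiniteMeasure_withDensity_ofReal (μ := (volume : Measure ℝ)) hk.2
  rw [withDensityv_eq_toSignedMeasure hk h0, VectorMeasure.integral_toSignedMeasure,
    integral_withDensity_eq_integral_toReal_smul (by fun_prop) (by simp)]
  simp [ENNReal.toReal_ofReal (h0 _)]

lemma integrable_withDensityv {k f : ℝ → ℝ} (hk : Integrable k) (hkm : Measurable k)
    (h0 : ∀ x, 0 ≤ k x) (hkf : Integrable fun y => k y * f y) :
    ((volume : Measure ℝ).withDensityᵥ k).Integrable f := by
  have := isFiniteMeasure_withDensity_ofReal (μ := (volume : Measure ℝ)) hk.2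
  rw [withDensityv_eq_toSignedMeasure hk h0, VectorMeasure.Integrable,
    Measure.variation_toSignedMeasure,
    integrable_withDensity_iff_integrable_smul' (by fun_prop) (by simp)]
  simpa [ENNReal.toReal_ofReal (h0 _)] using hkf

lemma conv_nematicPotential {l : ℝ} (hl : 0 < l) {f : ℝ → ℝ} (hf : MemLp f 2) (x : ℝ) :
    conv (nematicPotential l) f x = l⁻¹ / 2 * (leftAvg l⁻¹ f x + rightAvg l⁻¹ f x) := by
  have hβ : 0 < l⁻¹ := inv_pos.2 hl
  have hk : (fun x : ℝ => 1 / (2 * |l|) * Real.exp (-(|x| / |l|)))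
      = fun x => l⁻¹ / 2 * Real.exp (-(l⁻¹ * |x|)) := by
    funext x
    rw [abs_of_pos hl, div_eq_inv_mul |x| l]
    congr 1
    field_simp
  rw [conv, nematicPotential, hk, integral_withDensityv ((integrable_exp_neg_abs hβ).const_mul _)
    (by fun_prop) (fun x => by positivity), ← (integrable_exp_neg_abs_mul hβ hf x).2,
    ← integral_const_mul]
  simp only [mul_assoc]

lemma conv_deltaExpPotential {β l : ℝ} (hβ : 0 < β) (hl : l < 0) {f : ℝ → ℝ} (hf : MemLp f 2)
    (x : ℝ) :
    conv (deltaExpPotential β l) f x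
      = coeffA β l * (f x - l * (leftAvg β f x + rightAvg β f x)) := by
  obtain ⟨hint, heq⟩ := integrable_exp_neg_abs_mul hβ hf x
  have hk : (fun x : ℝ => l * Real.exp (-(β * |x|)))
      = fun x => -(-l * Real.exp (-(β * |x|))) := by
    funext x
    ring
  have hkint := (integrable_exp_neg_abs hβ).const_mul (-l)
  have hk0 : ∀ x, 0 ≤ -l * Real.exp (-(β * |x|)) :=
    fun x => mul_nonneg (by linarith) (Real.exp_pos _).le
  have hi1 : ((Measure.dirac (0 : ℝ)).toSignedMeasure).Integrable fun y => f (x - y) := by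
    rw [VectorMeasure.Integrable, Measure.variation_toSignedMeasure]
    exact integrable_dirac (by simp)
  have hi2 := integrable_withDensityv (f := fun y => f (x - y)) hkint (by fun_prop) hk0
    (by simpa only [mul_assoc] using hint.const_mul (-l))
  rw [conv, deltaExpPotential, hk, withDensityᵥ_neg', sub_neg_eq_add,
    VectorMeasure.integral_smul_vectorMeasure,
    VectorMeasure.integral_add_vectorMeasure hi1 hi2, VectorMeasure.integral_toSignedMeasure,
    integral_dirac, integral_withDensityv hkint (by fun_prop) hk0, ← heq, smul_eq_mul, sub_zero]
  simp only [mul_assoc]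
  rw [integral_const_mul]
  ring

lemma IsTest.deriv {φ : ℝ → ℝ} (hφ : IsTest φ) : IsTest (deriv φ) :=
  ⟨(contDiff_infty_iff_deriv.1 hφ.1).2, hφ.2.deriv⟩

lemma IsTest.hasDerivAt {φ : ℝ → ℝ} (hφ : IsTest φ) (x : ℝ) : HasDerivAt φ (_root_.deriv φ x) x :=
  ((contDiff_infty_iff_deriv.1 hφ.1).1 x).hasDerivAt

lemma IsTest.integrable_mul {φ : ℝ → ℝ} (hφ : IsTest φ) {f : ℝ → ℂ} (hf : Continuous f) :
    Integrable fun x => ((φ x : ℝ) : ℂ) * f x := by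
  refine Continuous.integrable_of_hasCompactSupport ?_ ?_
  · have := hφ.1.continuous
    fun_prop
  · refine HasCompactSupport.mul_right ?_
    exact hφ.2.comp_left (g := fun t : ℝ => (t : ℂ)) (by simp)

lemma IsTest.integral_deriv_mul {φ : ℝ → ℝ} (hφ : IsTest φ) {F f : ℝ → ℂ}
    (hF : ∀ x, HasDerivAt F (f x) x) (hf : Continuous f) :
    ∫ x, ((_root_.deriv φ x : ℝ) : ℂ) * F x = -∫ x, ((φ x : ℝ) : ℂ) * f x := by
  have hFc : Continuous F := continuous_iff_continuousAt.2 fun x => (hF x).continuousAt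
  rw [integral_mul_deriv_eq_deriv_mul_of_integrable
    (u := fun x => ((φ x : ℝ) : ℂ)) (u' := fun x => ((_root_.deriv φ x : ℝ) : ℂ))
    (fun x _ => (hφ.hasDerivAt x).ofReal_comp) (fun x _ => hF x)
    (hφ.integrable_mul hf) (hφ.deriv.integrable_mul hFc) (hφ.integrable_mul hFc), neg_neg]

lemma eq_affine_of_deriv_deriv_eq_zero {f f' : ℝ → ℂ} (hf : ∀ x, HasDerivAt f (f' x) x)
    (hf' : ∀ x, HasDerivAt f' 0 x) (x : ℝ) : f x = f 0 + (x : ℂ) * (f 1 - f 0) := by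
  have h1 : ∀ y, f' y = f' 0 := fun y =>
    is_const_of_deriv_eq_zero (fun x => (hf' x).differentiableAt) (fun x => (hf' x).deriv) y 0
  have hd : ∀ y, HasDerivAt (fun y : ℝ => f y - (y : ℂ) * f' 0) 0 y := fun y => by
    refine ((hf y).sub ((hasDerivAt_id y).ofReal_comp.mul_const (f' 0))).congr_deriv ?_
    simp [h1 y]
  have h2 : ∀ y, f y - (y : ℂ) * f' 0 = f 0 := fun y => by
    simpa using is_const_of_deriv_eq_zero (fun x => (hd x).differentiableAt)
      (fun x => (hd x).deriv) y 0
  have h3 := h2 1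
  have h4 := h2 x
  push_cast at h3
  linear_combination h4 - (x : ℂ) * h3

/-- A continuous function whose second distributional derivative vanishes is affine. -/
theorem eq_affine_of_integral_deriv_deriv_mul_eq_zero {w : ℝ → ℂ} (hw : Continuous w)
    (h : ∀ φ : ℝ → ℝ, IsTest φ → ∫ x, ((deriv (deriv φ) x : ℝ) : ℂ) * w x = 0) (x : ℝ) :
    w x = w 0 + (x : ℂ) * (w 1 - w 0) := by
  let b : ℕ → ContDiffBump (0 : ℝ) := fun n =>
    ⟨1 / ((n : ℝ) + 1) / 2, 1 / ((n : ℝ) + 1), by positivity, half_lt_self (by positivity)⟩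
  have hb : Tendsto (fun n => (b n).rOut) atTop (𝓝 0) := tendsto_one_div_add_atTop_nhds_zero_nat
  let m : ℕ → ℝ → ℂ := fun n => convolution ((b n).normed volume) w
    (ContinuousLinearMap.lsmul ℝ ℝ) volume
  have hm : ∀ y, Tendsto (fun n => m n y) atTop (𝓝 (w y)) := fun y =>
    ContDiffBump.convolution_tendsto_right_of_continuous hb hw y
  have haff : ∀ n y, m n y = m n 0 + (y : ℂ) * (m n 1 - m n 0) := by
    intro n
    have ht : IsTest ((b n).normed volume) := ⟨(b n).contDiff_normed, (b n).hasCompactSupport_normed⟩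
    have ht' := ht.deriv
    have hloc : LocallyIntegrable w := hw.locallyIntegrable
    refine eq_affine_of_deriv_deriv_eq_zero
      (fun y => ht.2.hasDerivAt_convolution_left _ (ht.1.of_le (by norm_cast)) hloc y)
      fun y => ?_
    refine (ht'.2.hasDerivAt_convolution_left _
      (ht'.1.of_le (by norm_cast)) hloc y).congr_deriv ?_
    rw [convolution_eq_swap]
    have htest : IsTest fun t => (b n).normed volume (y - t) :=
      ⟨ht.1.comp (contDiff_const.sub contDiff_id), ht.2.comp_homeomorph (Homeomorph.subLeft y)⟩
    have h0 := h _ htest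
    have hd1 : deriv (fun t => (b n).normed volume (y - t))
        = fun t => -deriv ((b n).normed volume) (y - t) := by
      funext t
      rw [deriv_comp_const_sub]
    have hd2 : deriv (deriv (fun t => (b n).normed volume (y - t)))
        = fun t => deriv (deriv ((b n).normed volume)) (y - t) := by
      rw [hd1]
      funext t
      rw [deriv.fun_neg, deriv_comp_const_sub, neg_neg]
    rw [hd2] at h0
    simpa using h0
  refine tendsto_nhds_unique (hm x) ?_
  simp_rw [haff _ x]
  exact (hm 0).add (((hm 1).sub (hm 0)).const_mul _)

lemma hasDerivAt_integral_of_continuous {f : ℝ → ℂ} (hf : Continuous f) (x : ℝ) :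
    HasDerivAt (fun x => ∫ t in (0 : ℝ)..x, f t) (f x) x :=
  intervalIntegral.integral_hasDerivAt_right (hf.intervalIntegrable _ _)
    (hf.stronglyMeasurableAtFilter _ _) hf.continuousAt

/-- A continuous distributional solution of `i c u' + u'' + u V = 0` with `V` continuous is a
classical solution. -/
theorem exists_hasDerivAt_of_weak {c : ℝ} {u : ℝ → ℂ} {V : ℝ → ℝ} (hu : Continuous u)
    (hV : Continuous V)
    (h : ∀ φ : ℝ → ℝ, IsTest φ →
      ∫ x, (-(Complex.I * (c : ℂ) * u x * ((deriv φ x : ℝ) : ℂ))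
        + u x * ((deriv (deriv φ) x : ℝ) : ℂ)
        + u x * ((V x : ℝ) : ℂ) * ((φ x : ℝ) : ℂ)) = 0) :
    ∃ u' : ℝ → ℂ, (∀ x, HasDerivAt u (u' x) x) ∧
      ∀ x, HasDerivAt u' (-(Complex.I * c * u' x) - u x * V x) x := by
  have huV : Continuous fun x => u x * (V x : ℂ) := by fun_prop
  set U : ℝ → ℂ := fun x => ∫ t in (0 : ℝ)..x, u t with hU
  set k : ℝ → ℂ := fun x => ∫ t in (0 : ℝ)..x, u t * (V t : ℂ) with hk
  have hUd : ∀ x, HasDerivAt U (u x) x := hasDerivAt_integral_of_continuous hu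
  have hkd : ∀ x, HasDerivAt k (u x * V x) x := hasDerivAt_integral_of_continuous huV
  have hkc : Continuous k := continuous_iff_continuousAt.2 fun x => (hkd x).continuousAt
  have hUc : Continuous U := continuous_iff_continuousAt.2 fun x => (hUd x).continuousAt
  set K : ℝ → ℂ := fun x => ∫ t in (0 : ℝ)..x, k t with hK
  have hKd : ∀ x, HasDerivAt K (k x) x := hasDerivAt_integral_of_continuous hkc
  have hKc : Continuous K := continuous_iff_continuousAt.2 fun x => (hKd x).continuousAt
  set w : ℝ → ℂ := fun x => u x + Complex.I * c * U x + K x with hw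
  have hwc : Continuous w := by fun_prop
  have haff := eq_affine_of_integral_deriv_deriv_mul_eq_zero hwc fun φ hφ => by
    have e1 := hφ.deriv.integral_deriv_mul hUd hu
    have e2 := hφ.deriv.integral_deriv_mul hKd hkc
    have e3 := hφ.integral_deriv_mul hkd huV
    have i1 := hφ.deriv.deriv.integrable_mul hu
    have i2 := (hφ.deriv.deriv.integrable_mul hUc).const_mul (Complex.I * c)
    have i3 := hφ.deriv.deriv.integrable_mul hKc
    have i4 := (hφ.deriv.integrable_mul hu).const_mul (Complex.I * c)
    have i5 := hφ.integrable_mul huV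
    have i12 : Integrable fun x => ((deriv (deriv φ) x : ℝ) : ℂ) * u x
        + Complex.I * c * (((deriv (deriv φ) x : ℝ) : ℂ) * U x) := i1.add i2
    have i14 : Integrable fun x => ((deriv (deriv φ) x : ℝ) : ℂ) * u x
        - Complex.I * c * (((deriv φ x : ℝ) : ℂ) * u x) := i1.sub i4
    have e4 : ∫ x, ((deriv (deriv φ) x : ℝ) : ℂ) * w x
        = (∫ x, ((deriv (deriv φ) x : ℝ) : ℂ) * u x)
          + Complex.I * c * (∫ x, ((deriv (deriv φ) x : ℝ) : ℂ) * U x)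
          + ∫ x, ((deriv (deriv φ) x : ℝ) : ℂ) * K x := by
      rw [← integral_const_mul, ← integral_add i1 i2, ← integral_add i12 i3]
      refine integral_congr_ae (Eventually.of_forall fun x => ?_)
      simp only [hw]
      ring
    have e5 := h φ hφ
    have e6 : ∫ x, (-(Complex.I * (c : ℂ) * u x * ((deriv φ x : ℝ) : ℂ))
        + u x * ((deriv (deriv φ) x : ℝ) : ℂ) + u x * ((V x : ℝ) : ℂ) * ((φ x : ℝ) : ℂ))
        = (∫ x, ((deriv (deriv φ) x : ℝ) : ℂ) * u x)
          - Complex.I * c * (∫ x, ((deriv φ x : ℝ) : ℂ) * u x)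
          + ∫ x, ((φ x : ℝ) : ℂ) * (u x * V x) := by
      rw [← integral_const_mul, ← integral_sub i1 i4, ← integral_add i14 i5]
      refine integral_congr_ae (Eventually.of_forall fun x => ?_)
      simp only
      ring
    rw [e6] at e5
    rw [e4, e1, e2, e3]
    linear_combination e5
  set B : ℂ := w 1 - w 0 with hB
  refine ⟨fun x => B - Complex.I * c * u x - k x, ?_, ?_⟩
  all_goals
    have hud : ∀ x, HasDerivAt u (B - Complex.I * c * u x - k x) x := fun x => by
      have heq : u = fun x : ℝ => w 0 + (x : ℂ) * B - Complex.I * c * U x - K x := by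
        funext y
        have := haff y
        simp only [hw] at this ⊢
        linear_combination this
      have h1 := (((((hasDerivAt_id x).ofReal_comp.mul_const B).const_add (w 0)).sub
        ((hUd x).const_mul (Complex.I * c))).sub (hKd x))
      rw [heq]
      refine h1.congr_deriv ?_
      rw [← heq]
      simp
  · exact hud
  · intro x
    refine ((((hud x).const_mul (Complex.I * c)).const_sub B).sub (hkd x)).congr_deriv ?_
    ring

/-- The classical derivative coincides with the weak one. -/
lemma memLp_deriv_of_isWeakDeriv {u u' g : ℝ → ℂ} (hu : ∀ x, HasDerivAt u (u' x) x)
    (hu' : Continuous u') (hg : IsWeakDeriv u g) (hg2 : MemLp g 2) : MemLp u' 2 := by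
  refine hg2.ae_eq ?_
  refine ae_eq_of_integral_contDiff_smul_eq hg.2.1 hu'.locallyIntegrable fun φ h1 h2 => ?_
  have hφ : IsTest φ := ⟨h1, h2⟩
  have e1 := hg.2.2 φ hφ
  rw [hφ.integral_deriv_mul hu hu', neg_inj] at e1
  simpa using e1.symm

lemma integral_le_of_nonneg {f : ℝ → ℝ} (hf : Integrable f) (h0 : ∀ x, 0 ≤ f x) {a b : ℝ}
    (hab : a ≤ b) : ∫ x in a..b, f x ≤ ∫ x, f x := by
  rw [intervalIntegral.integral_of_le hab]
  exact setIntegral_le_integral hf (Eventually.of_forall h0)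

lemma eta_eq (u : ℝ → ℂ) (x : ℝ) : eta u x = 1 - ((u x).re ^ 2 + (u x).im ^ 2) := by
  rw [eta, ← Complex.normSq_eq_norm_sq, Complex.normSq_apply]
  ring

lemma continuous_eta {u : ℝ → ℂ} (hu : Continuous u) : Continuous (eta u) := by
  unfold eta
  fun_prop

/-- Functions of finite energy are bounded. -/
lemma exists_norm_le {u u' : ℝ → ℂ} (hu : ∀ x, HasDerivAt u (u' x) x) (hu' : Continuous u')
    (hL : MemLp u' 2) (hη : MemLp (eta u) 2) : ∃ M, 0 < M ∧ ∀ x, ‖u x‖ ≤ M := by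
  have huc : Continuous u := continuous_iff_continuousAt.2 fun x => (hu x).continuousAt
  have hηc := continuous_eta huc
  have hi1 : Integrable fun x => ‖u' x‖ ^ 2 :=
    (memLp_two_iff_integrable_sq_norm hu'.aestronglyMeasurable).1 hL
  have hi2 : Integrable fun x => eta u x ^ 2 :=
    (memLp_two_iff_integrable_sq hηc.aestronglyMeasurable).1 hη
  set E := ∫ x, ‖u' x‖ ^ 2 with hE
  set F := ∫ x, eta u x ^ 2 with hF
  have hE0 : 0 ≤ E := integral_nonneg fun _ => sq_nonneg _
  have hF0 : 0 ≤ F := integral_nonneg fun _ => sq_nonneg _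
  refine ⟨(1 + E) + (F + 4), by positivity, fun x => ?_⟩
  have hy : ∃ y ∈ Set.Icc x (x + 1), eta u y ^ 2 ≤ F + 1 := by
    by_contra! hcon
    have h1 : ∫ y in x..(x + 1), (F + 1) ≤ ∫ y in x..(x + 1), eta u y ^ 2 :=
      intervalIntegral.integral_mono_on (by linarith)
        intervalIntegrable_const (by apply Continuous.intervalIntegrable; fun_prop)
        fun y hy => (hcon y hy).le
    have h2 := integral_le_of_nonneg hi2 (fun _ => sq_nonneg _) (show x ≤ x + 1 by linarith)
    simp at h1
    linarith
  obtain ⟨y, hy, hηy⟩ := hy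
  have h1 : ‖u y‖ ≤ F + 4 := by
    have : ‖u y‖ ^ 2 = 1 - eta u y := by rw [eta]; ring
    nlinarith [sq_nonneg (eta u y + 1), sq_nonneg (‖u y‖ - 1)]
  have h2 : ‖u y - u x‖ ≤ 1 + E := by
    rw [← intervalIntegral.integral_eq_sub_of_hasDerivAt (fun z _ => hu z)
      (hu'.intervalIntegrable _ _)]
    calc ‖∫ z in x..y, u' z‖ ≤ ∫ z in x..y, ‖u' z‖ :=
          intervalIntegral.norm_integral_le_integral_norm hy.1
      _ ≤ ∫ z in x..y, (1 + ‖u' z‖ ^ 2) := by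
        refine intervalIntegral.integral_mono_on hy.1
          (by apply Continuous.intervalIntegrable; fun_prop)
          (by apply Continuous.intervalIntegrable; fun_prop) fun z _ => ?_
        nlinarith [sq_nonneg (‖u' z‖ - 1), norm_nonneg (u' z)]
      _ = (y - x) + ∫ z in x..y, ‖u' z‖ ^ 2 := by
        rw [intervalIntegral.integral_add intervalIntegrable_const
          (by apply Continuous.intervalIntegrable; fun_prop)]
        simp
      _ ≤ 1 + E := by
        gcongr
        · linarith [hy.2]
        · exact integral_le_of_nonneg hi1 (fun _ => sq_nonneg _) hy.1
  calc ‖u x‖ = ‖u y - (u y - u x)‖ := by simp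
    _ ≤ ‖u y‖ + ‖u y - u x‖ := norm_sub_le _ _
    _ ≤ _ := by linarith

/-- Classical solutions, of finite energy, of `i c u' + u'' + u V = 0`, where
`V = A η + (1 - A) Z` and `Z` is the convolution of `η = 1 - |u|²` with the probability density
`β e^{-β|x|} / 2`. -/
structure IsWave (β A c : ℝ) (u u' : ℝ → ℂ) (η V Z : ℝ → ℝ) : Prop where
  beta_pos : 0 < β
  eta_def : η = eta u
  z_def : Z = fun x => β / 2 * (leftAvg β η x + rightAvg β η x)
  v_def : V = fun x => A * η x + (1 - A) * Z x
  hasDerivAt : ∀ x, HasDerivAt u (u' x) x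
  hasDerivAt' : ∀ x, HasDerivAt u' (-(Complex.I * c * u' x) - u x * V x) x
  memLp_eta : MemLp η 2
  memLp_deriv : MemLp u' 2

namespace IsWave

variable {β A c : ℝ} {u u' : ℝ → ℂ} {η V Z : ℝ → ℝ}

lemma continuous (h : IsWave β A c u u' η V Z) : Continuous u :=
  continuous_iff_continuousAt.2 fun x => (h.hasDerivAt x).continuousAt

lemma continuous' (h : IsWave β A c u u' η V Z) : Continuous u' :=
  continuous_iff_continuousAt.2 fun x => (h.hasDerivAt' x).continuousAt

lemma continuous_eta (h : IsWave β A c u u' η V Z) : Continuous η := by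
  rw [h.eta_def]
  exact NonlocalGP.continuous_eta h.continuous

lemma eta_eq (h : IsWave β A c u u' η V Z) (x : ℝ) :
    η x = 1 - ((u x).re ^ 2 + (u x).im ^ 2) := by
  rw [h.eta_def, NonlocalGP.eta_eq]

lemma hasDerivAt_re (h : IsWave β A c u u' η V Z) (x : ℝ) :
    HasDerivAt (fun x => (u x).re) (u' x).re x :=
  Complex.reCLM.hasFDerivAt.comp_hasDerivAt x (h.hasDerivAt x)

lemma hasDerivAt_im (h : IsWave β A c u u' η V Z) (x : ℝ) :
    HasDerivAt (fun x => (u x).im) (u' x).im x :=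
  Complex.imCLM.hasFDerivAt.comp_hasDerivAt x (h.hasDerivAt x)

lemma hasDerivAt_re' (h : IsWave β A c u u' η V Z) (x : ℝ) :
    HasDerivAt (fun x => (u' x).re) (c * (u' x).im - (u x).re * V x) x := by
  refine (Complex.reCLM.hasFDerivAt.comp_hasDerivAt x (h.hasDerivAt' x)).congr_deriv ?_
  simp

lemma hasDerivAt_im' (h : IsWave β A c u u' η V Z) (x : ℝ) :
    HasDerivAt (fun x => (u' x).im) (-(c * (u' x).re) - (u x).im * V x) x := by
  refine (Complex.imCLM.hasFDerivAt.comp_hasDerivAt x (h.hasDerivAt' x)).congr_deriv ?_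
  simp

lemma hasDerivAt_eta (h : IsWave β A c u u' η V Z) (x : ℝ) :
    HasDerivAt η (-(2 * ((u x).re * (u' x).re + (u x).im * (u' x).im))) x := by
  have heq : η = fun x => 1 - ((u x).re ^ 2 + (u x).im ^ 2) := funext h.eta_eq
  rw [heq]
  refine ((((h.hasDerivAt_re x).pow 2).add ((h.hasDerivAt_im x).pow 2)).const_sub 1).congr_deriv ?_
  simp
  ring

/-- The derivative of `Z`. -/
lemma hasDerivAt_z (h : IsWave β A c u u' η V Z) (x : ℝ) :
    HasDerivAt Z (β ^ 2 / 2 * (rightAvg β η x - leftAvg β η x)) x := by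
  rw [h.z_def]
  refine (((hasDerivAt_leftAvg h.beta_pos h.memLp_eta h.continuous_eta x).add
    (hasDerivAt_rightAvg h.beta_pos h.memLp_eta h.continuous_eta x)).const_mul _).congr_deriv ?_
  ring

lemma hasDerivAt_z' (h : IsWave β A c u u' η V Z) (x : ℝ) :
    HasDerivAt (fun x => β ^ 2 / 2 * (rightAvg β η x - leftAvg β η x))
      (β ^ 2 * (Z x - η x)) x := by
  rw [h.z_def]
  refine (((hasDerivAt_rightAvg h.beta_pos h.memLp_eta h.continuous_eta x).sub
    (hasDerivAt_leftAvg h.beta_pos h.memLp_eta h.continuous_eta x)).const_mul _).congr_deriv ?_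
  ring

lemma exists_norm_le (h : IsWave β A c u u' η V Z) : ∃ M, 0 < M ∧ ∀ x, ‖u x‖ ≤ M :=
  NonlocalGP.exists_norm_le h.hasDerivAt h.continuous' h.memLp_deriv (h.eta_def ▸ h.memLp_eta)

lemma exists_abs_eta_le (h : IsWave β A c u u' η V Z) : ∃ M, ∀ x, |η x| ≤ M := by
  obtain ⟨M, -, hM⟩ := h.exists_norm_le
  refine ⟨1 + M ^ 2, fun x => ?_⟩
  rw [h.eta_def, eta]
  have h1 : ‖u x‖ ^ 2 ≤ M ^ 2 := by gcongr; exact hM x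
  rw [abs_le]
  constructor <;> nlinarith [sq_nonneg ‖u x‖]

lemma abs_inner_le (z w : ℂ) : |z.re * w.re + z.im * w.im| ≤ ‖z‖ * ‖w‖ := by
  have := Complex.abs_re_le_norm (star z * w)
  simpa using this

lemma abs_wedge_le (z w : ℂ) : |z.re * w.im - z.im * w.re| ≤ ‖z‖ * ‖w‖ := by
  have := Complex.abs_im_le_norm (star z * w)
  simpa [sub_eq_add_neg] using this

lemma tendsto_eta (h : IsWave β A c u u' η V Z) :
    Tendsto η atBot (𝓝 0) ∧ Tendsto η atTop (𝓝 0) := by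
  obtain ⟨M, hM0, hM⟩ := h.exists_norm_le
  have hηc := h.continuous_eta
  have hi2 : Integrable fun x => η x ^ 2 :=
    (memLp_two_iff_integrable_sq hηc.aestronglyMeasurable).1 h.memLp_eta
  set η' : ℝ → ℝ := fun x => -(2 * ((u x).re * (u' x).re + (u x).im * (u' x).im)) with hη'
  have hη'c : Continuous η' := by
    have := h.continuous
    have := h.continuous'
    fun_prop
  have hη'2 : MemLp η' 2 := by
    refine h.memLp_deriv.of_le_mul (c := 2 * M) hη'c.aestronglyMeasurable
      (Eventually.of_forall fun x => ?_)
    rw [hη']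
    simp only [norm_neg, norm_mul, Real.norm_ofNat, Real.norm_eq_abs]
    rw [mul_assoc]
    gcongr
    exact (abs_inner_le _ _).trans (by gcongr; exact hM x)
  have hd : ∀ x, HasDerivAt (fun x => η x ^ 2) (2 * (η x * η' x)) x := fun x => by
    refine ((h.hasDerivAt_eta x).pow 2).congr_deriv ?_
    simp [hη']
    ring
  have hi3 : Integrable fun x => 2 * (η x * η' x) :=
    Integrable.const_mul (h.memLp_eta.integrable_mul hη'2) 2
  have key : ∀ l : Filter ℝ, Tendsto (fun x => η x ^ 2) l (𝓝 0) → Tendsto η l (𝓝 0) := by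
    intro l hl
    rw [tendsto_zero_iff_abs_tendsto_zero]
    have := (Real.continuous_sqrt.tendsto 0).comp hl
    simpa [Function.comp_def, Real.sqrt_sq_eq_abs] using this
  exact ⟨key _ (tendsto_zero_of_hasDerivAt_of_integrableOn_Iic (a := 0) (fun x _ => hd x)
      hi3.integrableOn hi2.integrableOn),
    key _ (tendsto_zero_of_hasDerivAt_of_integrableOn_Ioi (a := 0) (fun x _ => hd x)
      hi3.integrableOn hi2.integrableOn)⟩

lemma tendsto_avg (h : IsWave β A c u u' η V Z) :
    Tendsto (leftAvg β η) atBot (𝓝 0) ∧ Tendsto (rightAvg β η) atBot (𝓝 0) := by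
  obtain ⟨M, hM⟩ := h.exists_abs_eta_le
  exact ⟨tendsto_leftAvg_atBot h.beta_pos h.continuous_eta hM h.tendsto_eta.1,
    tendsto_rightAvg_atBot h.beta_pos h.continuous_eta hM h.tendsto_eta.1⟩

lemma tendsto_z (h : IsWave β A c u u' η V Z) : Tendsto Z atBot (𝓝 0) := by
  rw [h.z_def]
  simpa using (h.tendsto_avg.1.add h.tendsto_avg.2).const_mul (β / 2)

/-- Energy identity. -/
lemma normSq_deriv_eq (h : IsWave β A c u u' η V Z) (x : ℝ) :
    (u' x).re ^ 2 + (u' x).im ^ 2 = A * η x ^ 2 / 2 + (1 - A) * (Z x * η x - Z x ^ 2 / 2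
      + (β ^ 2 / 2 * (rightAvg β η x - leftAvg β η x)) ^ 2 / (2 * β ^ 2)) := by
  have hβ := h.beta_pos
  set Z' : ℝ → ℝ := fun x => β ^ 2 / 2 * (rightAvg β η x - leftAvg β η x) with hZ'
  set E : ℝ → ℝ := fun x => A * η x ^ 2 / 2 + (1 - A) * (Z x * η x - Z x ^ 2 / 2
      + Z' x ^ 2 / (2 * β ^ 2)) with hE
  set T : ℝ → ℝ := fun x => (u' x).re ^ 2 + (u' x).im ^ 2 with hT
  have hEd : ∀ x, HasDerivAt E (V x * (-(2 * ((u x).re * (u' x).re + (u x).im * (u' x).im)))) x := by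
    intro x
    have h1 := h.hasDerivAt_eta x
    have h2 := h.hasDerivAt_z x
    have h3 := h.hasDerivAt_z' x
    refine ((((h1.pow 2).const_mul A).div_const 2).add ((((h2.mul h1).sub
      ((h2.pow 2).div_const 2)).add ((h3.pow 2).div_const (2 * β ^ 2))).const_mul
        (1 - A))).congr_deriv ?_
    rw [h.v_def]
    field_simp
    ring
  have hTd : ∀ x, HasDerivAt T (V x * (-(2 * ((u x).re * (u' x).re + (u x).im * (u' x).im)))) x := by
    intro x
    refine (((h.hasDerivAt_re' x).pow 2).add ((h.hasDerivAt_im' x).pow 2)).congr_deriv ?_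
    simp
    ring
  have hconst : ∀ y, T y - E y = T x - E x := fun y =>
    is_const_of_deriv_eq_zero (f := fun z => T z - E z)
      (fun z => ((hTd z).sub (hEd z)).differentiableAt)
      (fun z => ((hTd z).sub (hEd z)).deriv.trans (sub_self _)) y x
  have hElim : Tendsto E atBot (𝓝 0) := by
    have hZ'l : Tendsto Z' atBot (𝓝 0) := by
      simpa using (h.tendsto_avg.2.sub h.tendsto_avg.1).const_mul (β ^ 2 / 2)
    have h1 := (((h.tendsto_eta.1.pow 2).const_mul A).div_const 2).add
      ((((h.tendsto_z.mul h.tendsto_eta.1).sub ((h.tendsto_z.pow 2).div_const 2)).add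
        ((hZ'l.pow 2).div_const (2 * β ^ 2))).const_mul (1 - A))
    simpa using h1
  have hTlim : Tendsto T atBot (𝓝 (T x - E x)) := by
    have h1 := hElim.add_const (T x - E x)
    rw [zero_add] at h1
    refine h1.congr fun y => ?_
    linarith [hconst y]
  have hTint : Integrable T := by
    refine ((memLp_two_iff_integrable_sq_norm h.continuous'.aestronglyMeasurable).1
      h.memLp_deriv).congr (Eventually.of_forall fun y => ?_)
    simp only [hT]
    rw [← Complex.normSq_eq_norm_sq, Complex.normSq_apply]
    ring
  have h0 : T x - E x = 0 := by
    refine IntegrableAtFilter.eq_zero_of_tendsto ⟨Set.univ, univ_mem, hTint.integrableOn⟩ ?_ hTlim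
    intro s hs
    obtain ⟨b, hb⟩ := mem_atBot_sets.1 hs
    rw [← top_le_iff, ← Real.volume_Iic (a := b)]
    exact measure_mono hb
  exact sub_eq_zero.1 h0

lemma tendsto_norm_deriv (h : IsWave β A c u u' η V Z) : Tendsto (fun x => ‖u' x‖) atBot (𝓝 0) := by
  have hβ := h.beta_pos
  have hT : Tendsto (fun x => ‖u' x‖ ^ 2) atBot (𝓝 0) := by
    have hZ'l : Tendsto (fun x => β ^ 2 / 2 * (rightAvg β η x - leftAvg β η x)) atBot (𝓝 0) := by
      simpa using (h.tendsto_avg.2.sub h.tendsto_avg.1).const_mul (β ^ 2 / 2)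
    have h1 := (((h.tendsto_eta.1.pow 2).const_mul A).div_const 2).add
      ((((h.tendsto_z.mul h.tendsto_eta.1).sub ((h.tendsto_z.pow 2).div_const 2)).add
        ((hZ'l.pow 2).div_const (2 * β ^ 2))).const_mul (1 - A))
    simp only [ne_eq, OfNat.ofNat_ne_zero, not_false_eq_true, zero_pow, mul_zero, zero_div,
      sub_zero, add_zero] at h1
    refine h1.congr fun x => ?_
    rw [← h.normSq_deriv_eq x, ← Complex.normSq_eq_norm_sq, Complex.normSq_apply]
    ring
  have := (Real.continuous_sqrt.tendsto 0).comp hT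
  simpa [Function.comp_def, Real.sqrt_sq (norm_nonneg _)] using this

/-- Momentum identity. -/
lemma wedge_eq (h : IsWave β A c u u' η V Z) (x : ℝ) :
    (u x).re * (u' x).im - (u x).im * (u' x).re = c / 2 * η x := by
  obtain ⟨M, hM0, hM⟩ := h.exists_norm_le
  set J : ℝ → ℝ := fun x => (u x).re * (u' x).im - (u x).im * (u' x).re - c / 2 * η x with hJ
  have hJd : ∀ x, HasDerivAt J 0 x := fun x => by
    refine ((((h.hasDerivAt_re x).mul (h.hasDerivAt_im' x)).sub
      ((h.hasDerivAt_im x).mul (h.hasDerivAt_re' x))).sub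
        ((h.hasDerivAt_eta x).const_mul (c / 2))).congr_deriv ?_
    ring
  have hconst : ∀ y, J y = J x := fun y =>
    is_const_of_deriv_eq_zero (fun z => (hJd z).differentiableAt) (fun z => (hJd z).deriv) y x
  have h1 : Tendsto (fun y => (u y).re * (u' y).im - (u y).im * (u' y).re) atBot (𝓝 0) := by
    refine squeeze_zero_norm (a := fun y => M * ‖u' y‖) (fun y => ?_)
      (by simpa using h.tendsto_norm_deriv.const_mul M)
    exact (abs_wedge_le _ _).trans (by gcongr; exact hM y)
  have h2 : Tendsto J atBot (𝓝 0) := by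
    simpa using h1.sub (h.tendsto_eta.1.const_mul (c / 2))
  have h3 : J x = 0 := tendsto_nhds_unique (tendsto_const_nhds.congr fun y => (hconst y).symm) h2
  exact sub_eq_zero.1 h3

/-- The equation satisfied by `η`. -/
lemma hasDerivAt_eta' (h : IsWave β A c u u' η V Z) (x : ℝ) :
    HasDerivAt (fun x => -(2 * ((u x).re * (u' x).re + (u x).im * (u' x).im)))
      ((2 * A - c ^ 2) * η x + 2 * (1 - A) * Z x
        + (-(2 * ((u' x).re ^ 2 + (u' x).im ^ 2)) - 2 * η x * V x)) x := by
  refine ((((h.hasDerivAt_re x).mul (h.hasDerivAt_re' x)).add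
    ((h.hasDerivAt_im x).mul (h.hasDerivAt_im' x))).const_mul 2).neg.congr_deriv ?_
  have h1 := h.wedge_eq x
  have h2 := h.eta_eq x
  have h3 : V x = A * η x + (1 - A) * Z x := by rw [h.v_def]
  linear_combination (-2 * c) * h1 + 2 * V x * h2 + 2 * h3

end IsWave

lemma leftAvg_const_mul (β σ : ℝ) (f : ℝ → ℝ) (x : ℝ) :
    leftAvg β (fun y => σ * f y) x = σ * leftAvg β f x := by
  simp only [leftAvg, ← integral_const_mul]
  congr 1 with y
  ring

lemma rightAvg_const_mul (β σ : ℝ) (f : ℝ → ℝ) (x : ℝ) :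
    rightAvg β (fun y => σ * f y) x = σ * rightAvg β f x := by
  simp only [rightAvg, ← integral_const_mul]
  congr 1 with y
  ring

/-- The two-sided exponential average of a continuous nonnegative function which is not identically
zero is positive. -/
lemma leftAvg_add_rightAvg_pos {β : ℝ} (hβ : 0 < β) {f : ℝ → ℝ} (hf : MemLp f 2)
    (hc : Continuous f) (h0 : ∀ x, 0 ≤ f x) (hne : ∃ x, f x ≠ 0) (x : ℝ) :
    0 < leftAvg β f x + rightAvg β f x := by
  refine lt_of_le_of_ne (add_nonneg (leftAvg_nonneg h0 x) (rightAvg_nonneg h0 x)) fun heq => ?_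
  obtain ⟨hint, hval⟩ := integrable_exp_neg_abs_mul hβ hf x
  rw [← heq, integral_eq_zero_iff_of_nonneg
    (fun y => mul_nonneg (Real.exp_pos _).le (h0 _)) hint] at hval
  have hcont : Continuous fun y => Real.exp (-(β * |y|)) * f (x - y) := by fun_prop
  have hz := (hcont.ae_eq_iff_eq volume continuous_zero).1 hval
  obtain ⟨z, hz'⟩ := hne
  have := congrFun hz (x - z)
  simp only [sub_sub_cancel, Pi.zero_apply, mul_eq_zero, Real.exp_ne_zero, false_or] at this
  exact hz' this

/-- A nonnegative function which is nondecreasing near `-∞` is controlled by the exponential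
average of its future. -/
lemma le_rightAvg {β : ℝ} (hβ : 0 < β) {f : ℝ → ℝ} (hf : MemLp f 2)
    (hc : Continuous f) (h0 : ∀ x, 0 ≤ f x) {a : ℝ} (hm : MonotoneOn f (Set.Iic a)) {x : ℝ}
    (hx : x ≤ a - 1) : f x ≤ Real.exp β * rightAvg β f x := by
  have hd : ∀ y, HasDerivAt (fun y => -(Real.exp (-β * y) * rightAvg β f y))
      (Real.exp (-β * y) * f y) y := fun y => by
    refine ((hasDerivAt_exp_mul (-β) y).mul (hasDerivAt_rightAvg hβ hf hc y)).neg.congr_deriv ?_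
    ring
  obtain ⟨ξ, hξ, hξe⟩ := exists_hasDerivAt_eq_slope _ _ (show x < x + 1 by linarith)
    (fun y _ => (hd y).continuousAt.continuousWithinAt) (fun y _ => hd y)
  rw [add_sub_cancel_left, div_one] at hξe
  have h1 : f x ≤ f ξ :=
    hm (Set.mem_Iic.2 (by linarith)) (Set.mem_Iic.2 (by linarith [hξ.2])) hξ.1.le
  have h2 : Real.exp (-β * (x + 1)) ≤ Real.exp (-β * ξ) :=
    Real.exp_le_exp.2 (by nlinarith [hξ.2])
  have h3 : 0 ≤ Real.exp (-β * (x + 1)) * rightAvg β f (x + 1) :=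
    mul_nonneg (Real.exp_pos _).le (rightAvg_nonneg h0 _)
  have h4 : Real.exp (-β * (x + 1)) * f x ≤ Real.exp (-β * x) * rightAvg β f x := by
    have := mul_le_mul h2 h1 (h0 x) (Real.exp_pos _).le
    linarith
  calc f x = Real.exp (β * (x + 1)) * (Real.exp (-β * (x + 1)) * f x) := by
        rw [← mul_assoc, ← Real.exp_add]
        simp
    _ ≤ Real.exp (β * (x + 1)) * (Real.exp (-β * x) * rightAvg β f x) :=
        mul_le_mul_of_nonneg_left h4 (Real.exp_pos _).le
    _ = Real.exp β * rightAvg β f x := by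
        rw [← mul_assoc, ← Real.exp_add]
        ring_nf

namespace IsWave

variable {β A c : ℝ} {u u' : ℝ → ℂ} {η V Z : ℝ → ℝ}

/-- A finite energy solution of constant modulus one is constant. -/
lemma exists_eta_ne_zero (h : IsWave β A c u u' η V Z) (hne : ¬ ∃ a : ℂ, ∀ x, u x = a) :
    ∃ x, η x ≠ 0 := by
  by_contra! h0
  have hη : η = fun _ => 0 := funext h0
  have hL : ∀ x, leftAvg β η x = 0 := fun x => by simp [leftAvg, hη]
  have hR : ∀ x, rightAvg β η x = 0 := fun x => by simp [rightAvg, hη]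
  have hZ : ∀ x, Z x = 0 := fun x => by simp [h.z_def, hL, hR]
  have hu' : ∀ x, u' x = 0 := fun x => by
    have h1 := h.normSq_deriv_eq x
    rw [hL, hR, hZ, h0 x] at h1
    refine Complex.normSq_eq_zero.1 ?_
    rw [Complex.normSq_apply]
    linear_combination h1
  refine hne ⟨u 0, fun x => ?_⟩
  exact is_const_of_deriv_eq_zero (fun y => (h.hasDerivAt y).differentiableAt)
    (fun y => by rw [(h.hasDerivAt y).deriv, hu']) x 0

/-- If the characteristic polynomial has no nonnegative root, then `η` cannot have a constant sign
and be monotone near `-∞` with vanishing limit. -/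
theorem not_signed_monotone (h : IsWave β A c u u' η V Z)
    (hP : ∀ S : ℝ, 0 ≤ S → 0 < 2 * (1 - A) * β ^ 2 + (2 * A - c ^ 2 - S) * (β ^ 2 - S))
    (hne : ¬ ∃ a : ℂ, ∀ x, u x = a) {σ : ℝ} (hσ : σ ^ 2 = 1) {x₀ : ℝ}
    (h0 : ∀ x, 0 ≤ σ * η x) (hd : ∀ x < x₀, 0 ≤ σ * deriv η x) : False := by
  have hβ := h.beta_pos
  have hηc := h.continuous_eta
  obtain ⟨M, hM0, hM⟩ := h.exists_norm_le
  have hσabs : |σ| = 1 := by rw [← Real.sqrt_sq_eq_abs, hσ, Real.sqrt_one]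
  have hσ0 : σ ≠ 0 := fun h => by norm_num [h] at hσ
  have habs : ∀ t, |σ * t| = |t| := fun t => by rw [abs_mul, hσabs, one_mul]
  set f : ℝ → ℝ := fun x => σ * η x with hf
  have hfc : Continuous f := by fun_prop
  have hfL : MemLp f 2 := h.memLp_eta.const_mul σ
  set η' : ℝ → ℝ := fun x => -(2 * ((u x).re * (u' x).re + (u x).im * (u' x).im)) with hη'
  set Z' : ℝ → ℝ := fun x => β ^ 2 / 2 * (rightAvg β η x - leftAvg β η x) with hZ'
  set N : ℝ → ℝ := fun x => -(2 * ((u' x).re ^ 2 + (u' x).im ^ 2)) - 2 * η x * V x with hN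
  have hfd : ∀ x, HasDerivAt f (σ * η' x) x := fun x => (h.hasDerivAt_eta x).const_mul σ
  have hmono : MonotoneOn f (Set.Iic x₀) := monotoneOn_Iic_of_hasDerivAt hfd fun x hx => by
    have := hd x hx
    rwa [(h.hasDerivAt_eta x).deriv] at this
  have hY : ∀ x, σ * Z x = β / 2 * (leftAvg β f x + rightAvg β f x) := fun x => by
    rw [hf, leftAvg_const_mul, rightAvg_const_mul, h.z_def]
    ring
  have hYpos : ∀ x, 0 < σ * Z x := fun x => by
    rw [hY]
    obtain ⟨z, hz⟩ := h.exists_eta_ne_zero hne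
    exact mul_pos (half_pos hβ) (leftAvg_add_rightAvg_pos hβ hfL hfc h0
      ⟨z, mul_ne_zero hσ0 hz⟩ x)
  have hY' : ∀ x, |σ * Z' x| ≤ β * (σ * Z x) := fun x => by
    have e : σ * Z' x = β ^ 2 / 2 * (rightAvg β f x - leftAvg β f x) := by
      rw [hf, leftAvg_const_mul, rightAvg_const_mul, hZ']
      ring
    have hl := leftAvg_nonneg (β := β) h0 x
    have hr := rightAvg_nonneg (β := β) h0 x
    rw [hY, e, abs_mul, abs_of_pos (by positivity)]
    calc β ^ 2 / 2 * |rightAvg β f x - leftAvg β f x|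
        ≤ β ^ 2 / 2 * (leftAvg β f x + rightAvg β f x) := by
          gcongr
          rw [abs_le]
          constructor <;> linarith
      _ = _ := by ring
  set C : ℝ := Real.exp β * (2 / β) with hC
  have hC0 : 0 < C := by positivity
  have hfle : ∀ x ≤ x₀ - 1, |f x| ≤ C * (σ * Z x) := fun x hx => by
    rw [abs_of_nonneg (h0 x), hY]
    have hl := leftAvg_nonneg (β := β) h0 x
    calc f x ≤ Real.exp β * rightAvg β f x := le_rightAvg hβ hfL hfc h0 hmono hx
      _ ≤ Real.exp β * (leftAvg β f x + rightAvg β f x) := by gcongr; linarith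
      _ = _ := by rw [hC]; field_simp
  set K : ℝ := |A| * C ^ 2 / 2 + |1 - A| * (C + 1) with hK
  have hK0 : 0 ≤ K := by positivity
  have hT : ∀ x ≤ x₀ - 1, (u' x).re ^ 2 + (u' x).im ^ 2 ≤ K * (σ * Z x) ^ 2 := fun x hx => by
    have hy := hYpos x
    have h1 : |η x| ≤ C * (σ * Z x) := by
      rw [← habs]
      exact hfle x hx
    have h2 : |Z x| = σ * Z x := by rw [← habs, abs_of_pos hy]
    have h3 : |Z' x| ≤ β * (σ * Z x) := by
      rw [← habs]
      exact hY' x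
    have h4 : |Z x * η x - Z x ^ 2 / 2 + Z' x ^ 2 / (2 * β ^ 2)| ≤ (C + 1) * (σ * Z x) ^ 2 := by
      have a1 : |Z x * η x| ≤ C * (σ * Z x) ^ 2 := by
        rw [abs_mul, h2]
        nlinarith
      have a2 : Z x ^ 2 = (σ * Z x) ^ 2 := by rw [mul_pow, hσ, one_mul]
      have a3 : Z' x ^ 2 / (2 * β ^ 2) ≤ (σ * Z x) ^ 2 / 2 := by
        rw [div_le_div_iff₀ (by positivity) (by positivity), ← sq_abs (Z' x)]
        nlinarith [pow_le_pow_left₀ (abs_nonneg _) h3 2]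
      have a4 : 0 ≤ Z' x ^ 2 / (2 * β ^ 2) := by positivity
      rw [abs_le] at a1 ⊢
      constructor <;> nlinarith [a1.1, a1.2, sq_nonneg (σ * Z x)]
    rw [h.normSq_deriv_eq x]
    refine (le_abs_self _).trans ((abs_add_le _ _).trans ?_)
    rw [abs_mul (1 - A), abs_div, abs_mul A, abs_of_nonneg (sq_nonneg (η x)), abs_two]
    have h5 : η x ^ 2 ≤ (C * (σ * Z x)) ^ 2 := by
      rw [← sq_abs]
      exact pow_le_pow_left₀ (abs_nonneg _) h1 2
    calc |A| * η x ^ 2 / 2 + |1 - A| * |Z x * η x - Z x ^ 2 / 2 + Z' x ^ 2 / (2 * β ^ 2)|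
        ≤ |A| * (C * (σ * Z x)) ^ 2 / 2 + |1 - A| * ((C + 1) * (σ * Z x) ^ 2) := by gcongr
      _ = K * (σ * Z x) ^ 2 := by rw [hK]; ring
  have hη'le : ∀ x ≤ x₀ - 1, |σ * η' x| ≤ (2 * M * (K + 1)) * (σ * Z x) := fun x hx => by
    have hy := hYpos x
    have h1 : ‖u' x‖ ≤ (K + 1) * (σ * Z x) := by
      refine abs_le_of_sq_le_sq' ?_ (by positivity) |>.2
      rw [← Complex.normSq_eq_norm_sq, Complex.normSq_apply, ← sq, ← sq]
      refine (hT x hx).trans ?_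
      rw [mul_pow (K + 1)]
      exact mul_le_mul_of_nonneg_right (by nlinarith) (sq_nonneg _)
    rw [habs, hη']
    simp only
    rw [abs_neg, abs_mul, abs_two]
    calc 2 * |(u x).re * (u' x).re + (u x).im * (u' x).im| ≤ 2 * (‖u x‖ * ‖u' x‖) := by
          gcongr
          exact abs_inner_le _ _
      _ ≤ 2 * (M * ((K + 1) * (σ * Z x))) := by
          gcongr
          exact hM x
      _ = _ := by ring
  have hNle : ∀ x ≤ x₀ - 1, |σ * N x| ≤ (2 * K + 2 * C * (|A| * C + |1 - A|)) * (σ * Z x) ^ 2 :=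
      fun x hx => by
    have hy := hYpos x
    have h1 : |η x| ≤ C * (σ * Z x) := by
      rw [← habs]
      exact hfle x hx
    have h2 : |Z x| = σ * Z x := by rw [← habs, abs_of_pos hy]
    have h3 : |V x| ≤ (|A| * C + |1 - A|) * (σ * Z x) := by
      rw [h.v_def]
      refine (abs_add_le _ _).trans ?_
      rw [abs_mul, abs_mul, h2, add_mul, mul_assoc]
      gcongr
    rw [habs, hN]
    simp only
    refine (abs_sub _ _).trans ?_
    rw [abs_neg, abs_of_nonneg (by positivity), abs_mul, abs_mul, abs_two]
    calc 2 * ((u' x).re ^ 2 + (u' x).im ^ 2) + 2 * |η x| * |V x|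
        ≤ 2 * (K * (σ * Z x) ^ 2) + 2 * (C * (σ * Z x)) * ((|A| * C + |1 - A|) * (σ * Z x)) := by
          gcongr
          exact hT x hx
      _ = _ := by ring
  set D : ℝ := C + 2 * M * (K + 1) + (2 * K + 2 * C * (|A| * C + |1 - A|)) with hD
  have p1 : 0 ≤ 2 * M * (K + 1) := by positivity
  have p2 : 0 ≤ 2 * K + 2 * C * (|A| * C + |1 - A|) := by positivity
  refine not_exists_dominated_solution (β := β) (κ := 2 * A - c ^ 2) (B := 2 * (1 - A)) (C := D)
    (a := x₀ - 1) (h := f) (h' := fun x => σ * η' x) (Y := fun x => σ * Z x)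
    (Y' := fun x => σ * Z' x) (n := fun x => σ * N x) hβ (by positivity) hP hfd ?_ ?_ ?_
    (fun x _ => hYpos x) (fun x _ => hY' x) ?_ ?_ ?_ ?_
  · intro x
    refine ((h.hasDerivAt_eta' x).const_mul σ).congr_deriv ?_
    simp only [hf, hN]
    ring
  · exact fun x => (h.hasDerivAt_z x).const_mul σ
  · intro x
    refine ((h.hasDerivAt_z' x).const_mul σ).congr_deriv ?_
    simp only [hf]
    ring
  · exact fun x hx => (hfle x hx).trans
      (mul_le_mul_of_nonneg_right (by rw [hD]; linarith) (hYpos x).le)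
  · exact fun x hx => (hη'le x hx).trans
      (mul_le_mul_of_nonneg_right (by rw [hD]; linarith) (hYpos x).le)
  · exact fun x hx => (hNle x hx).trans
      (mul_le_mul_of_nonneg_right (by rw [hD]; linarith) (sq_nonneg _))
  · simpa using h.tendsto_z.const_mul σ

/-- A finite energy solution at zero speed which tends to `1` at `+∞` is real-valued. -/
lemma im_eq_zero (h : IsWave β A 0 u u' η V Z) (htop : Tendsto u atTop (𝓝 1)) (x : ℝ) :
    (u x).im = 0 := by
  have hre : Tendsto (fun x => (u x).re) atTop (𝓝 1) := (Complex.continuous_re.tendsto 1).comp htop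
  have him : Tendsto (fun x => (u x).im) atTop (𝓝 0) := (Complex.continuous_im.tendsto 1).comp htop
  obtain ⟨X, hX⟩ := eventually_atTop.1 (hre.eventually_const_lt zero_lt_one)
  have hq : ∀ y ∈ Set.Ici X, HasDerivAt (fun y => (u y).im / (u y).re) 0 y := fun y hy => by
    refine ((h.hasDerivAt_im y).div (h.hasDerivAt_re y) (hX y hy).ne').congr_deriv ?_
    rw [div_eq_zero_iff]
    left
    linear_combination h.wedge_eq y
  have him0 : ∀ y, X ≤ y → (u y).im = 0 := fun y hy => by
    have hconst : ∀ z, y ≤ z → (u z).im / (u z).re = (u y).im / (u y).re := fun z hz => by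
      refine constant_of_has_deriv_right_zero (f := fun y => (u y).im / (u y).re) (a := y) (b := z)
        (fun t ht => (hq t (hy.trans ht.1)).continuousAt.continuousWithinAt)
        (fun t ht => (hq t (hy.trans ht.1)).hasDerivWithinAt) z ⟨hz, le_rfl⟩
    have hlim : Tendsto (fun z => (u z).im / (u z).re) atTop (𝓝 0) := by
      simpa [Pi.div_def] using him.div hre one_ne_zero
    have h0 : (u y).im / (u y).re = 0 := by
      refine tendsto_nhds_unique (tendsto_const_nhds.congr' ?_) hlim
      filter_upwards [eventually_ge_atTop y] with z hz using (hconst z hz).symm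
    exact (div_eq_zero_iff.1 h0).resolve_right (hX y hy).ne'
  rcases le_total X x with hx | hx
  · exact him0 x hx
  obtain ⟨M, hM⟩ := h.exists_abs_eta_le
  obtain ⟨K, hK⟩ : ∃ K, ∀ y, |V y| ≤ K := by
    refine ⟨|A| * M + |1 - A| * (β / 2 * (M * (∫ y in Set.Ioi 0, Real.exp (-(β * y)))
      + M * ∫ y in Set.Ioi 0, Real.exp (-(β * y)))), fun y => ?_⟩
    have hβ := h.beta_pos
    rw [h.v_def, h.z_def]
    refine (abs_add_le _ _).trans ?_
    rw [abs_mul, abs_mul, abs_mul, abs_of_pos (half_pos hβ)]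
    gcongr
    · exact hM y
    · exact (abs_add_le _ _).trans
        (add_le_add (abs_leftAvg_le hβ hM y) (abs_rightAvg_le hβ hM y))
  set e : ℝ → ℝ := fun y => Real.exp ((1 + K) * y) * ((u y).im ^ 2 + (u' y).im ^ 2) with he
  have hed : ∀ y, HasDerivAt e (Real.exp ((1 + K) * y) *
      ((1 + K) * ((u y).im ^ 2 + (u' y).im ^ 2) + 2 * (u y).im * (u' y).im * (1 - V y))) y := by
    intro y
    refine ((hasDerivAt_exp_mul (1 + K) y).mul
      (((h.hasDerivAt_im y).pow 2).add ((h.hasDerivAt_im' y).pow 2))).congr_deriv ?_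
    simp
    ring
  have hmono : MonotoneOn e (Set.Iic (X + 1)) := by
    refine monotoneOn_Iic_of_hasDerivAt hed fun y _ => mul_nonneg (Real.exp_pos _).le ?_
    have h1 := abs_le.1 (hK y)
    nlinarith [mul_nonneg (show 0 ≤ K + V y by linarith) (sq_nonneg ((u y).im - (u' y).im)),
      mul_nonneg (show 0 ≤ K - V y by linarith) (sq_nonneg ((u y).im + (u' y).im)),
      sq_nonneg ((u y).im + (u' y).im)]
  have hX0 : e (X + 1) = 0 := by
    have h1 : (u' (X + 1)).im = 0 := by
      refine (h.hasDerivAt_im (X + 1)).unique ?_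
      refine (hasDerivAt_const (X + 1) (0 : ℝ)).congr_of_eventuallyEq ?_
      filter_upwards [eventually_gt_nhds (show X < X + 1 by linarith)] with y hy
        using him0 y hy.le
    simp [he, him0 (X + 1) (by linarith), h1]
  have h2 : e x ≤ 0 := by
    rw [← hX0]
    exact hmono (Set.mem_Iic.2 (by linarith)) (Set.mem_Iic.2 le_rfl) (by linarith)
  have h3 : (u x).im ^ 2 + (u' x).im ^ 2 ≤ 0 := nonpos_of_mul_nonpos_right h2 (Real.exp_pos _)
  nlinarith [sq_nonneg (u x).im, sq_nonneg (u' x).im]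

/-- Monotone kinks have `η` nonnegative, and nondecreasing near `-∞`. -/
lemma signed_monotone_of_monotone_re (h : IsWave β A 0 u u' η V Z) (htop : Tendsto u atTop (𝓝 1))
    (hbot : Tendsto u atBot (𝓝 (-1))) (hm : Monotone fun x => (u x).re) :
    ∃ x₀ : ℝ, (∀ x, 0 ≤ η x) ∧ ∀ x < x₀, 0 ≤ deriv η x := by
  have him := h.im_eq_zero htop
  have hre : Tendsto (fun x => (u x).re) atTop (𝓝 1) := (Complex.continuous_re.tendsto 1).comp htop
  have hre' : Tendsto (fun x => (u x).re) atBot (𝓝 (-1)) := by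
    simpa [Function.comp_def] using (Complex.continuous_re.tendsto (-1)).comp hbot
  obtain ⟨x₀, hx₀⟩ := eventually_atBot.1 (hre'.eventually_lt_const (show (-1 : ℝ) < 0 by norm_num))
  refine ⟨x₀, fun x => ?_, fun x hx => ?_⟩
  · have h1 : (u x).re ≤ 1 := hm.ge_of_tendsto hre x
    have h2 : -1 ≤ (u x).re := hm.le_of_tendsto hre' x
    rw [h.eta_eq, him]
    nlinarith
  · have h1 : 0 ≤ (u' x).re := by
      rw [← (h.hasDerivAt_re x).deriv]
      exact hm.deriv_nonneg
    rw [(h.hasDerivAt_eta x).deriv, him]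
    nlinarith [hx₀ x hx.le]

end IsWave

/-- Weak solutions in the energy space are classical solutions. -/
theorem exists_isWave {β A c : ℝ} {W : SignedMeasure ℝ} {u : ℝ → ℂ} (hβ : 0 < β)
    (hW : ∀ x, conv W (eta u) x = A * eta u x
      + (1 - A) * (β / 2 * (leftAvg β (eta u) x + rightAvg β (eta u) x)))
    (hu : InEnergySpace u) (hsol : IsWeakSolution W c u) :
    ∃ u' V Z, IsWave β A c u u' (eta u) V Z := by
  obtain ⟨huc, hη, g, hg, hg2⟩ := hu
  have hηc := continuous_eta huc
  have hLc : Continuous (leftAvg β (eta u)) :=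
    continuous_iff_continuousAt.2 fun x => (hasDerivAt_leftAvg hβ hη hηc x).continuousAt
  have hRc : Continuous (rightAvg β (eta u)) :=
    continuous_iff_continuousAt.2 fun x => (hasDerivAt_rightAvg hβ hη hηc x).continuousAt
  have hVc : Continuous (conv W (eta u)) := by
    rw [show conv W (eta u) = _ from funext hW]
    fun_prop
  obtain ⟨u', h1, h2⟩ := exists_hasDerivAt_of_weak huc hVc hsol
  have hu'c : Continuous u' := continuous_iff_continuousAt.2 fun x => (h2 x).continuousAt
  exact ⟨u', conv W (eta u), _, hβ, rfl, rfl, funext hW, h1, h2, hη,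
    memLp_deriv_of_isWeakDeriv h1 hu'c hg hg2⟩

lemma tildeLambda_nonneg (c : ℝ) : 0 ≤ tildeLambda c := by
  unfold tildeLambda
  split_ifs <;> positivity

lemma charPoly_nematic_pos {c l : ℝ} (hc : c ^ 2 < 2) (hl : tildeLambda c < l) {S : ℝ}
    (hS : 0 ≤ S) :
    0 < 2 * (1 - 0) * l⁻¹ ^ 2 + (2 * 0 - c ^ 2 - S) * (l⁻¹ ^ 2 - S) := by
  have hl0 : 0 < l := (tildeLambda_nonneg c).trans_lt hl
  set r := √(2 - c ^ 2) with hr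
  have hr2 : r ^ 2 = 2 - c ^ 2 := Real.sq_sqrt (by linarith)
  have hr0 : 0 < r := Real.sqrt_pos.2 (by linarith)
  have h2 : √2 ^ 2 = 2 := Real.sq_sqrt (by norm_num)
  have h20 : 0 < √(2 : ℝ) := by positivity
  have key : 1 < c ^ 2 * l ^ 2 + 2 * l * r := by
    by_cases h0 : c = 0
    · rw [tildeLambda, if_pos h0, show (8 : ℝ) = 2 ^ 2 * 2 by norm_num, Real.sqrt_mul (by norm_num),
        Real.sqrt_sq (by norm_num), div_lt_iff₀ (by positivity)] at hl
      rw [hr, h0]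
      norm_num
      linarith
    · have hcp : 0 < c ^ 2 := by positivity
      have hle : r ≤ √2 := Real.sqrt_le_sqrt (by linarith)
      have h8 : √(8 * (2 - c ^ 2)) = 2 * √2 * r := by
        rw [show (8 : ℝ) = 2 ^ 2 * 2 by norm_num, Real.sqrt_mul (by norm_num),
          Real.sqrt_mul (by norm_num), Real.sqrt_sq (by norm_num)]
      have hq : 4 - c ^ 2 - √(8 * (2 - c ^ 2)) = (√2 - r) ^ 2 := by
        rw [h8]
        nlinarith
      rw [tildeLambda, if_neg h0, hq, Real.sqrt_sq (by linarith), inv_mul_lt_iff₀ hcp] at hl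
      have h3 : √2 ^ 2 < (c ^ 2 * l + r) ^ 2 := by
        gcongr
        linarith
      have h4 : 0 < c ^ 2 * (c ^ 2 * l ^ 2 + 2 * l * r - 1) := by nlinarith
      linarith [pos_of_mul_pos_right h4 hcp.le]
  have hmain : 0 < l ^ 2 * S ^ 2 - (1 - c ^ 2 * l ^ 2) * S + r ^ 2 := by
    have h5 := mul_nonneg hS (sub_nonneg.2 key.le)
    rcases hS.eq_or_lt with rfl | hS
    · nlinarith
    · nlinarith [sq_nonneg (l * S - r), mul_pos hS (sub_pos.2 key)]
  have heq : 2 * (1 - 0) * l⁻¹ ^ 2 + (2 * 0 - c ^ 2 - S) * (l⁻¹ ^ 2 - S)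
      = (l ^ 2 * S ^ 2 - (1 - c ^ 2 * l ^ 2) * S + r ^ 2) / l ^ 2 := by
    rw [hr2]
    field_simp
    ring
  rw [heq]
  positivity

lemma charPoly_deltaExp_pos {β l c : ℝ} (hβ : 0 < β) (hl : l < 0) (hc : c ^ 2 < 2)
    (h : ((deltaExpNumber β l c).im = 0 ∧ (deltaExpNumber β l c).re < 0) ∨
      (deltaExpNumber β l c).im ≠ 0) {S : ℝ} (hS : 0 ≤ S) :
    0 < 2 * (1 - coeffA β l) * β ^ 2 + (2 * coeffA β l - c ^ 2 - S) * (β ^ 2 - S) := by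
  set A := coeffA β l with hA
  have hA' : A * (β - 2 * l) = β := by
    rw [hA, coeffA]
    have : β - 2 * l ≠ 0 := by linarith
    field_simp
  set b := β ^ 2 + 2 * A - c ^ 2 with hb
  set q := β ^ 2 * (2 - c ^ 2) with hq
  have hq0 : 0 < q := mul_pos (by positivity) (by linarith)
  have hD : deltaExpDiscr β l c = b ^ 2 - 4 * q := by
    rw [deltaExpDiscr, ← hA, ← hb, hq]
    linear_combination (-8 * β) * hA'
  have hP : 2 * (1 - A) * β ^ 2 + (2 * A - c ^ 2 - S) * (β ^ 2 - S) = S ^ 2 - b * S + q := by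
    rw [hb, hq]
    ring
  rw [hP]
  rcases lt_or_ge (deltaExpDiscr β l c) 0 with hneg | hpos
  · rw [hD] at hneg
    nlinarith [sq_nonneg (2 * S - b)]
  · have hnum : deltaExpNumber β l c = ((b - √(deltaExpDiscr β l c) : ℝ) : ℂ) := by
      have hcpow := Complex.ofReal_cpow hpos (1 / 2)
      push_cast at hcpow
      rw [deltaExpNumber, ← hA, ← hb, Real.sqrt_eq_rpow, ← hcpow, ← Complex.ofReal_sub]
    rw [hnum] at h
    have hlt : b < √(deltaExpDiscr β l c) := by
      rcases h with h | h
      · have := h.2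
        rw [Complex.ofReal_re] at this
        linarith
      · exact absurd (Complex.ofReal_im _) h
    have hb0 : b < 0 := by
      by_contra! hb0
      have h1 := Real.lt_sqrt hb0 |>.1 hlt
      rw [hD] at h1
      linarith
    nlinarith [mul_nonneg (neg_nonneg.2 hb0.le) hS, sq_nonneg S]

/-- Both potentials are convex combinations of `δ₀` and `β e^{-β|x|} / 2`, with a characteristic
polynomial which is positive on the nonnegative half-line. -/
theorem exists_conv_eq {c : ℝ} (hc : c ^ 2 < 2) {W : SignedMeasure ℝ}
    (hW : (∃ l : ℝ, tildeLambda c < l ∧ W = nematicPotential l) ∨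
      (∃ β l : ℝ, 0 < β ∧ l < 0 ∧
        (((deltaExpNumber β l c).im = 0 ∧ (deltaExpNumber β l c).re < 0) ∨
          (deltaExpNumber β l c).im ≠ 0) ∧ W = deltaExpPotential β l)) :
    ∃ β A : ℝ, 0 < β ∧
      (∀ S : ℝ, 0 ≤ S → 0 < 2 * (1 - A) * β ^ 2 + (2 * A - c ^ 2 - S) * (β ^ 2 - S)) ∧
      ∀ f : ℝ → ℝ, MemLp f 2 → ∀ x, conv W f x
        = A * f x + (1 - A) * (β / 2 * (leftAvg β f x + rightAvg β f x)) := by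
  rcases hW with ⟨l, hl, rfl⟩ | ⟨β, l, hβ, hl, hnum, rfl⟩
  · have hl0 : 0 < l := (tildeLambda_nonneg c).trans_lt hl
    refine ⟨l⁻¹, 0, inv_pos.2 hl0, fun S hS => charPoly_nematic_pos hc hl hS, fun f hf x => ?_⟩
    rw [conv_nematicPotential hl0 hf]
    ring
  · refine ⟨β, coeffA β l, hβ, fun S hS => charPoly_deltaExp_pos hβ hl hc hnum hS,
      fun f hf x => ?_⟩
    rw [conv_deltaExpPotential hβ hl hf, coeffA]
    have : β - 2 * l ≠ 0 := by linarith
    field_simp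
    ring

end NonlocalGP

theorem theorem5p4 (c : ℝ) (hc₀ : 0 ≤ c) (hc : c < √2) (W : SignedMeasure ℝ)
    (hW : (∃ l : ℝ, NonlocalGP.tildeLambda c < l ∧ W = NonlocalGP.nematicPotential l) ∨
      (∃ β l : ℝ, 0 < β ∧ l < 0 ∧
        (((NonlocalGP.deltaExpNumber β l c).im = 0 ∧ (NonlocalGP.deltaExpNumber β l c).re < 0) ∨
          (NonlocalGP.deltaExpNumber β l c).im ≠ 0) ∧
        W = NonlocalGP.deltaExpPotential β l))
    (u : ℝ → ℂ) (hu : NonlocalGP.InEnergySpace u) (hsol : NonlocalGP.IsWeakSolution W c u)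
    (hnontriv : ¬ ∃ a : ℂ, ∀ x : ℝ, u x = a) :
    (¬ ∃ x₀ : ℝ, (∀ x : ℝ, 0 ≤ NonlocalGP.eta u x) ∧
        ∀ x : ℝ, x < x₀ → 0 ≤ deriv (NonlocalGP.eta u) x) ∧
      (¬ ∃ x₀ : ℝ, (∀ x : ℝ, NonlocalGP.eta u x ≤ 0) ∧
        ∀ x : ℝ, x < x₀ → deriv (NonlocalGP.eta u) x ≤ 0) ∧
      NonlocalGP.HasOscillation (NonlocalGP.eta u) ∧
      (c = 0 → Tendsto u atTop (𝓝 1) → Tendsto u atBot (𝓝 (-1)) →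
        ¬ Monotone fun x : ℝ => (u x).re) := by
  have hc2 : c ^ 2 < 2 := by
    rw [← Real.sq_sqrt (show (0 : ℝ) ≤ 2 by norm_num)]
    gcongr
  obtain ⟨β, A, hβ, hP, hconv⟩ := NonlocalGP.exists_conv_eq hc2 hW
  obtain ⟨u', V, Z, h⟩ := NonlocalGP.exists_isWave hβ (hconv _ hu.2.1) hu hsol
  have h1 : ¬ ∃ x₀ : ℝ, (∀ x : ℝ, 0 ≤ NonlocalGP.eta u x) ∧
      ∀ x : ℝ, x < x₀ → 0 ≤ deriv (NonlocalGP.eta u) x := by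
    rintro ⟨x₀, h0, hd⟩
    exact h.not_signed_monotone hP hnontriv (σ := 1) (x₀ := x₀) (by norm_num)
      (by simpa using h0) (by simpa using hd)
  have h2 : ¬ ∃ x₀ : ℝ, (∀ x : ℝ, NonlocalGP.eta u x ≤ 0) ∧
      ∀ x : ℝ, x < x₀ → deriv (NonlocalGP.eta u) x ≤ 0 := by
    rintro ⟨x₀, h0, hd⟩
    exact h.not_signed_monotone hP hnontriv (σ := -1) (x₀ := x₀) (by norm_num)
      (by simpa using h0) (by simpa using hd)
  refine ⟨h1, h2, NonlocalGP.hasOscillation_of_tendsto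
    (fun x => (h.hasDerivAt_eta x).differentiableAt) h.tendsto_eta.1 h.tendsto_eta.2 h1 h2, ?_⟩
  rintro rfl htop hbot hm
  exact h1 (h.signed_monotone_of_monotone_re htop hbot hm)
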